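/- **Setting.** Let $k$ be a difference field ($\sigma$-field) of characteristic $0$, i.e. a field with an endomorphism $\sigma$; $K$ ranges over the $\sigma$-field extensions of $k$. For a finite set $\mathbb Y=\{y_1,\dots,y_m\}$ of $\sigma$-indeterminates let $k\{\mathbb Y\}=k[\sigma^i(y_j): i\ge 0,\,1\le j\le m]$. An (affine) $\sigma$-variety over $k$ is a functor $X=\mathbb V(F)$, $X(K)=\{a\in K^m: f(a)=0\ \forall f\in F\}$, with $F\subseteq k\{\mathbb Y\}$; a morphism of $\sigma$-varieties is a family of maps $X(K)\to Y(K)$ given for all $K$ by the same $\sigma$-polynomials over $k$. Let $\mathbb I(X)$ be the ideal of the $\sigma$-polynomials that vanish on $X(K)$ for all $K$, and $k\{X\}=k\{\mathbb Y\}/\mathbb I(X)$. The topological space of $X$ is the set $\operatorname{Spec}^\sigma(k\{X\})$ of the prime ideals $\mathfrak p$ with $\sigma(a)\in\mathfrak p\Leftrightarrow a\in\mathfrak p$, with the Cohn topology, whose closed sets are the sets $\{\mathfrak p: F\subseteq\mathfrak p\}$; a point $x\in X(K)$ gives the element $\{f\in k\{X\}: f(x)=0\}$ of it. The Cohn closure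 of a family of subsets $W(K)\subseteq K^m$ is $\mathbb V(\mathbb I(W))$. For $p=\sum_i c_ix^i\in\mathbb Z[x]$ and $a\in K^*$ put $a^p=\prod_i\sigma^i(a)^{c_i}$, and $\mathbb T^{\mathbf u}=\prod_{i=1}^n t_i^{u_i}$ for $\mathbf u\in\mathbb Z[x]^n$, $\mathbb T\in (K^*)^n$. For $U=(\mathbf u_1,\dots,\mathbf u_m)$ with $\mathbf u_j\in\mathbb Z[x]^n$, the quasi $\sigma$-torus $T_U^*$ is given by $T^*_U(K)=\{(\mathbb T^{\mathbf u_1},\dots,\mathbb T^{\mathbf u_m}):\mathbb T\in (K^*)^n\}$. Let $X_U$ be the Cohn closure of $T_U^*$ in $\mathbb A^m$, and let $T_U$ be the Cohn $*$-closure of $T_U^*$ in $(\mathbb A^*)^m$, that is, the $\sigma$-variety which is the Cohn closure in $\mathbb A^{2m}$ of $\{(a,a^{-1}): a\in T_U^*\}$. A $\sigma$-variety is *toric* if it is isomorphic to some $X_U$. A *$\sigma$-torus* is a $\sigma$-variety isomorphic to some $T_U$, with the $\sigma$-algebraic group structure that corresponds to coordinatewise multiplication on $T_U$. A $\sigma$-algebraic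 group action of $T$ on $X$ is a morphism $T\times X\to X$ which for every $K$ is a group action of $T(K)$ on $X(K)$. **Theorem.** A $\sigma$-variety $X$ over $k$ is toric if and only if it contains a $\sigma$-torus $T$ as a dense Cohn-open subset, together with a $\sigma$-algebraic group action of $T$ on $X$ that extends the action of $T$ on itself by multiplication. Here "contains $T$ as a dense Cohn-open subset" means that there is a morphism $j\colon T\to X$ which is an isomorphism onto a dense Cohn-open subset of $X$: the image of $j$ in $\operatorname{Spec}^\sigma(k\{X\})$ is open and dense, each point of $X(K)$ that lies in it is $j(t)$ for exactly one $t\in T(K)$, and every $\sigma$-polynomial function on $T$ is, locally on this image, a quotient of $\sigma$-polynomial functions on $X$. The action extends that of $T$ on itself if $s\cdot j(t)=j(st)$ for all $s,t\in T(K)$ and all $K$. -/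

import Mathlib

universe u

/-- A difference ring (`σ`-ring): a commutative ring with a ring endomorphism `σ`. -/
class DifferenceRing (R : Type u) [CommRing R] where
  /-- the endomorphism `σ` -/
  shift : R →+* R

open DifferenceRing (shift)

/-- A `σ`-field extension `K` of the `σ`-field `k` (an object of the category `𝓔_k`). -/
structure SigmaExt (k : Type u) [Field k] [DifferenceRing k] where
  carrier : Type u
  [field : Field carrier]
  [diff : DifferenceRing carrier]
  [alg : Algebra k carrier]
  shift_algebraMap : ∀ a : k, shift (algebraMap k carrier a) = algebraMap k carrier (shift a)

namespace SigmaExt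

instance {k : Type u} [Field k] [DifferenceRing k] : CoeSort (SigmaExt k) (Type u) :=
  ⟨SigmaExt.carrier⟩

attribute [instance] SigmaExt.field SigmaExt.diff SigmaExt.alg

end SigmaExt

/-- The `σ`-polynomial ring `k{y_i : i ∈ ι}`; the variable `(i, j)` stands for `σ^j(y_i)`. -/
abbrev SigmaPoly (ι : Type) (k : Type u) [Field k] : Type u := MvPolynomial (ι × ℕ) k

/-- The `σ`-structure of `k{y_i : i ∈ ι}`: it extends `σ` on `k` and maps `σ^j(y_i)` to
`σ^(j+1)(y_i)`. -/
noncomputable instance SigmaPoly.instDifferenceRing (ι : Type) (k : Type u) [Field k]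
    [DifferenceRing k] : DifferenceRing (SigmaPoly ι k) where
  shift := MvPolynomial.eval₂Hom (MvPolynomial.C.comp shift)
    (fun p : ι × ℕ => MvPolynomial.X (p.1, p.2 + 1))

/-- The value `f(x)` of a `σ`-polynomial `f` at a point `x ∈ K^ι`. -/
noncomputable def SigmaPoly.eval {ι : Type} {k : Type u} [Field k] [DifferenceRing k]
    {K : SigmaExt k} (x : ι → K) : SigmaPoly ι k →ₐ[k] K :=
  MvPolynomial.aeval (fun p : ι × ℕ => (shift : K →+* K)^[p.2] (x p.1))

theorem SigmaPoly.eval_shift {ι : Type} {k : Type u} [Field k] [DifferenceRing k]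
    {K : SigmaExt k} (x : ι → K) (f : SigmaPoly ι k) :
    SigmaPoly.eval x (shift f) = shift (SigmaPoly.eval x f) := by
  induction f using MvPolynomial.induction_on with
  | C a => simp [shift, SigmaPoly.eval]; exact (K.shift_algebraMap a).symm
  | add p q hp hq => simp only [map_add, hp, hq]
  | mul_X p i hp =>
    rw [map_mul, map_mul, map_mul, map_mul, hp]
    congr 1
    change MvPolynomial.aeval _ (MvPolynomial.eval₂Hom _ _ (MvPolynomial.X i)) =
      (shift : K →+* K) (MvPolynomial.aeval _ (MvPolynomial.X i))
    rw [MvPolynomial.eval₂Hom_X', MvPolynomial.aeval_X, MvPolynomial.aeval_X]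
    exact Function.iterate_succ_apply' _ _ _

/-- A family of subsets `W(K) ⊆ K^ι`, one for every `σ`-field extension `K` of `k`. -/
abbrev PointFamily (k : Type u) [Field k] [DifferenceRing k] (ι : Type) : Type (u + 1) :=
  ∀ K : SigmaExt k, Set (ι → K)

/-- `𝕍(F)`: the common zeros of the set `F` of `σ`-polynomials. -/
def zeroFamily {k : Type u} [Field k] [DifferenceRing k] {ι : Type}
    (F : Set (SigmaPoly ι k)) : PointFamily k ι :=
  fun _ => {x | ∀ f ∈ F, SigmaPoly.eval x f = 0}

/-- `𝕀(W)`: the ideal of the `σ`-polynomials that vanish on `W(K)` for all `K`. -/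
def vanishingIdeal {k : Type u} [Field k] [DifferenceRing k] {ι : Type}
    (W : PointFamily k ι) : Ideal (SigmaPoly ι k) where
  carrier := {f | ∀ (K : SigmaExt k), ∀ x ∈ W K, SigmaPoly.eval x f = 0}
  add_mem' := fun hf hg K x hx => by rw [map_add, hf K x hx, hg K x hx, add_zero]
  zero_mem' := fun _ _ _ => map_zero _
  smul_mem' := fun c f hf K x hx => by rw [smul_eq_mul, map_mul, hf K x hx, mul_zero]

/-- An affine difference variety (`σ`-variety) over `k`: a functor on the `σ`-field extensions
of `k` of the form `𝕍(F)`, for a set `F` of `σ`-polynomials in finitely many variables. -/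
structure SigmaVariety (k : Type u) [Field k] [DifferenceRing k] where
  /-- the finite index set of the coordinates -/
  ι : Type
  [fin : Finite ι]
  pts : PointFamily k ι
  exists_eq : ∃ F : Set (SigmaPoly ι k), pts = zeroFamily F

attribute [instance] SigmaVariety.fin

/-- The Cohn closure `𝕍(𝕀(W))` of `W` in affine space `𝔸^ι`. -/
def cohnClosure {k : Type u} [Field k] [DifferenceRing k] {ι : Type} [Finite ι]
    (W : PointFamily k ι) : SigmaVariety k where
  ι := ι
  pts := zeroFamily (vanishingIdeal W : Set (SigmaPoly ι k))
  exists_eq := ⟨_, rfl⟩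

/-! ### Coordinate rings and the Cohn topology -/

/-- `Spec^σ R`: the `σ`-prime ideals of `R`, that is, the prime ideals `p` with `σ(a) ∈ p` if and
only if `a ∈ p`. It carries the Cohn topology, whose closed sets are the sets
`{p | F ⊆ p}`, `F ⊆ R` (the topology induced by the Zariski topology). -/
abbrev SigmaSpec (R : Type u) [CommRing R] [DifferenceRing R] : Type u :=
  {p : PrimeSpectrum R // ∀ a : R, shift a ∈ p.asIdeal ↔ a ∈ p.asIdeal}

namespace SigmaVariety

variable {k : Type u} [Field k] [DifferenceRing k]

/-- The `σ`-coordinate ring `k{X} = k{Y}/𝕀(X)`. -/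
abbrev CoordRing (X : SigmaVariety k) : Type u := SigmaPoly X.ι k ⧸ vanishingIdeal X.pts

theorem shift_mem_vanishingIdeal {ι : Type} (W : PointFamily k ι) {f : SigmaPoly ι k}
    (hf : f ∈ vanishingIdeal W) : shift f ∈ vanishingIdeal W := fun K x hx => by
  rw [SigmaPoly.eval_shift, hf K x hx, map_zero]

noncomputable instance (X : SigmaVariety k) : DifferenceRing X.CoordRing where
  shift := Ideal.quotientMap (vanishingIdeal X.pts) shift
    (fun _ hf => shift_mem_vanishingIdeal X.pts hf)

/-- The evaluation map `k{X} → K` at a point `x ∈ X(K)`. -/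
noncomputable def evalAt (X : SigmaVariety k) {K : SigmaExt k} (x : X.pts K) : X.CoordRing →+* K :=
  Ideal.Quotient.lift (vanishingIdeal X.pts) (SigmaPoly.eval x.1).toRingHom
    (fun _ hf => hf K x.1 x.2)

theorem evalAt_shift (X : SigmaVariety k) {K : SigmaExt k} (x : X.pts K) (a : X.CoordRing) :
    X.evalAt x (shift a) = shift (X.evalAt x a) := by
  obtain ⟨f, rfl⟩ := Ideal.Quotient.mk_surjective a
  exact SigmaPoly.eval_shift x.1 f

/-- The element of the topological space `Spec^σ(k{X})` given by a point `x ∈ X(K)`: the ideal of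
the functions in `k{X}` that vanish at `x`. -/
noncomputable def toSpec (X : SigmaVariety k) {K : SigmaExt k} (x : X.pts K) :
    SigmaSpec X.CoordRing :=
  ⟨⟨RingHom.ker (X.evalAt x), RingHom.ker_isPrime _⟩, fun a => by
    rw [RingHom.mem_ker, RingHom.mem_ker, evalAt_shift, map_eq_zero]⟩

/-! ### Morphisms, products, groups, actions -/

/-- A morphism of `σ`-varieties: maps `X(K) → Y(K)` given, for all `K`, by the same
`σ`-polynomials over `k`. -/
structure Hom (X Y : SigmaVariety k) where
  map : ∀ {K : SigmaExt k}, X.pts K → Y.pts K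
  exists_poly : ∃ P : Y.ι → SigmaPoly X.ι k, ∀ (K : SigmaExt k) (x : X.pts K) (i : Y.ι),
    (map x).1 i = SigmaPoly.eval x.1 (P i)

/-- An isomorphism of `σ`-varieties. -/
structure Iso (X Y : SigmaVariety k) where
  hom : Hom X Y
  inv : Hom Y X
  inv_hom : ∀ (K : SigmaExt k) (x : X.pts K), inv.map (hom.map x) = x
  hom_inv : ∀ (K : SigmaExt k) (y : Y.pts K), hom.map (inv.map y) = y

theorem eval_rename {ι κ : Type} (g : ι → κ) {K : SigmaExt k} (x : κ → K) (f : SigmaPoly ι k) :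
    SigmaPoly.eval x (MvPolynomial.rename (Prod.map g id) f) = SigmaPoly.eval (x ∘ g) f := by
  rw [SigmaPoly.eval, MvPolynomial.aeval_rename]
  rfl

/-- The product `X × Y`, with `(X × Y)(K) = X(K) × Y(K) ⊆ K^ι × K^κ = K^(ι ⊕ κ)`. -/
def prod (X Y : SigmaVariety k) : SigmaVariety k where
  ι := X.ι ⊕ Y.ι
  pts := fun K => {z | z ∘ Sum.inl ∈ X.pts K ∧ z ∘ Sum.inr ∈ Y.pts K}
  exists_eq := by
    obtain ⟨F, hF⟩ := X.exists_eq
    obtain ⟨G, hG⟩ := Y.exists_eq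
    refine ⟨MvPolynomial.rename (Prod.map Sum.inl id) '' F ∪
      MvPolynomial.rename (Prod.map Sum.inr id) '' G, ?_⟩
    funext K
    ext z
    simp only [hF, hG, zeroFamily, Set.mem_ofPred_eq, Set.mem_union, or_imp, forall_and,
      Set.forall_mem_image, eval_rename]

/-- The point `(x, y)` of `X × Y`. -/
def pair {X Y : SigmaVariety k} {K : SigmaExt k} (x : X.pts K) (y : Y.pts K) :
    (X.prod Y).pts K :=
  ⟨Sum.elim x.1 y.1, by
    constructor
    · rw [Sum.elim_comp_inl]; exact x.2
    · rw [Sum.elim_comp_inr]; exact y.2⟩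

/-- A `σ`-algebraic group structure on `G`: a group structure on every `G(K)` whose
multiplication and inverse map are morphisms of `σ`-varieties. -/
structure GroupStructure (G : SigmaVariety k) where
  mul : Hom (G.prod G) G
  inv : Hom G G
  one : ∀ K : SigmaExt k, G.pts K
  mul_assoc : ∀ (K : SigmaExt k) (a b c : G.pts K),
    mul.map (pair (mul.map (pair a b)) c) = mul.map (pair a (mul.map (pair b c)))
  one_mul : ∀ (K : SigmaExt k) (a : G.pts K), mul.map (pair (one K) a) = a
  inv_mul_cancel : ∀ (K : SigmaExt k) (a : G.pts K), mul.map (pair (inv.map a) a) = one K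

/-- A `σ`-algebraic group action of `G` on `X`. -/
structure Action {G : SigmaVariety k} (H : GroupStructure G) (X : SigmaVariety k) where
  act : Hom (G.prod X) X
  one_act : ∀ (K : SigmaExt k) (x : X.pts K), act.map (pair (H.one K) x) = x
  mul_act : ∀ (K : SigmaExt k) (a b : G.pts K) (x : X.pts K),
    act.map (pair (H.mul.map (pair a b)) x) = act.map (pair a (act.map (pair b x)))

/-! ### Open immersions -/

/-- The image of a morphism in the topological space `Spec^σ(k{X})` of the target: all elements
given by points `j(t)`, `t ∈ T(K)`. -/
def Hom.image {T X : SigmaVariety k} (j : Hom T X) : Set (SigmaSpec X.CoordRing) :=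
  {p | ∃ (K : SigmaExt k) (t : T.pts K), p = X.toSpec (j.map t)}

/-- The morphism `j` identifies `T` with a Cohn-open subset of `X`: the image is Cohn-open, every
point of `X` in it comes from exactly one point of `T`, and the inverse is regular (every function
on `T` is, locally, a quotient of functions on `X`). -/
structure Hom.IsOpenImmersion {T X : SigmaVariety k} (j : Hom T X) : Prop where
  isOpen_image : IsOpen j.image
  exists_map_eq : ∀ (K : SigmaExt k) (x : X.pts K), X.toSpec x ∈ j.image → ∃ t, j.map t = x
  injective : ∀ (K : SigmaExt k) (s t : T.pts K), j.map s = j.map t → s = t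
  regular_inverse : ∀ (f : SigmaPoly T.ι k) (K : SigmaExt k) (t : T.pts K),
    ∃ a b : SigmaPoly X.ι k, SigmaPoly.eval (j.map t).1 b ≠ 0 ∧
      ∀ (K' : SigmaExt k) (s : T.pts K'),
        SigmaPoly.eval (j.map s).1 b * SigmaPoly.eval s.1 f = SigmaPoly.eval (j.map s).1 a

end SigmaVariety

/-! ### Toric `σ`-varieties and `σ`-tori -/

section Toric

open Polynomial

/-- `a^p = ∏_i σ^i(a)^(c_i)` for `p = ∑_i c_i x^i ∈ ℤ[x]` and a nonzero element `a` of a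
`σ`-field. -/
noncomputable def sigmaPow {K : Type u} [Field K] [DifferenceRing K] (a : K) (p : ℤ[X]) : K :=
  ∏ i ∈ p.support, ((shift : K →+* K)^[i] a) ^ (p.coeff i)

/-- The Laurent `σ`-monomial `t^v = ∏_i t_i^(v_i)`, for `v ∈ ℤ[x]^n`. -/
noncomputable def laurentMonomial {K : Type u} [Field K] [DifferenceRing K] {n : ℕ}
    (t : Fin n → K) (v : Fin n → ℤ[X]) : K :=
  ∏ i, sigmaPow (t i) (v i)

variable (k : Type u) [Field k] [DifferenceRing k]

/-- The quasi `σ`-torus `T_U^*`, the image of `(𝔸^*)^n → 𝔸^m, t ↦ (t^(u_1), …, t^(u_m))`. -/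
def quasiTorus {n m : ℕ} (U : Fin m → Fin n → ℤ[X]) : PointFamily k (Fin m) :=
  fun K => {y | ∃ t : Fin n → K, (∀ i, t i ≠ 0) ∧ y = fun j => laurentMonomial t (U j)}

/-- The variety `X_U`: the Cohn closure of `T_U^*` in `𝔸^m`. -/
def toricVariety {n m : ℕ} (U : Fin m → Fin n → ℤ[X]) : SigmaVariety k :=
  cohnClosure (quasiTorus k U)

/-- The Cohn `*`-closure `T_U` of `T_U^*` in `(𝔸^*)^m`, as a `σ`-variety: the Cohn closure
in `𝔸^(2m)` of the image of `T_U^*` under `θ(a) = (a, a⁻¹)`. -/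
def torusVariety {n m : ℕ} (U : Fin m → Fin n → ℤ[X]) : SigmaVariety k :=
  cohnClosure (ι := Fin m ⊕ Fin m)
    (fun K => {z | ∃ y ∈ quasiTorus k U K, z = Sum.elim y (fun j => (y j)⁻¹)})

variable {k}

/-- `X` is toric: it is isomorphic to `X_U` for some finite family `U` in some `ℤ[x]^n`. -/
def SigmaVariety.IsToric (X : SigmaVariety k) : Prop :=
  ∃ (n m : ℕ) (U : Fin m → Fin n → ℤ[X]), Nonempty (SigmaVariety.Iso X (toricVariety k U))

/-- `T`, with the group structure `H`, is a `σ`-torus: `T` is isomorphic to the Cohn `*`-closure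
of a quasi `σ`-torus, and `H` corresponds to its natural group structure, which is the
coordinatewise multiplication. -/
def SigmaVariety.GroupStructure.IsTorus {T : SigmaVariety k} (H : T.GroupStructure) : Prop :=
  ∃ (n m : ℕ) (U : Fin m → Fin n → ℤ[X]) (e : SigmaVariety.Iso T (torusVariety k U)),
    ∀ (K : SigmaExt k) (a b : T.pts K),
      (e.hom.map (H.mul.map (SigmaVariety.pair a b))).1 =
        (e.hom.map a).1 * (e.hom.map b).1

end Toric

/-! Suppose `X` is `X_U`. The closure of a monomial map is cut out by binomial equations
(`mem_cohnClosure_monomialFamily_iff`), which are stable under coordinatewise products. Hence `T_U`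
is a group and acts on `X_U` by multiplication. It sits in `X_U` as the locus where no coordinate
vanishes, which is open, and dense because `X_U` is a closure of `T_U^*`.

Conversely, let `T_U` act on `X` through a dense `J : T_U → X`. Each coordinate of `J(t)` is a
Laurent sum `∑ c_w t^w`, and the same coordinate of `s·x` is `∑ b_w(x) s^w` with `σ`-polynomials
`b_w`. Comparing both sides of `s·J(t) = J(st)` gives `b_w(J(t)) = c_w t^w`, since Laurent monomials
at a generic `s` are linearly independent over the field of `t` (`exists_generic`,
`exists_component`). So every monomial `t^w` that occurs in `J` is a function on `X`, and the
coordinates of `X` are linear combinations of these finitely many monomials. By density this gives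
mutually inverse morphisms between `X` and `X_{U'}`, where `U'` lists the exponents that occur
(`isToric_of_action`). -/

section Evaluation

variable {k : Type u} [Field k] [DifferenceRing k]

/-! ### Evaluation and substitution of `σ`-polynomials. -/

namespace SigmaPoly

theorem eval_C {ι : Type} {K : SigmaExt k} (x : ι → K) (a : k) :
    eval x (MvPolynomial.C a) = algebraMap k K a := by
  rw [eval, MvPolynomial.aeval_C]

theorem eval_X {ι : Type} {K : SigmaExt k} (x : ι → K) (p : ι × ℕ) :
    eval x (MvPolynomial.X p) = (shift : K →+* K)^[p.2] (x p.1) := by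
  rw [eval, MvPolynomial.aeval_X]

theorem eval_iterate_shift {ι : Type} {K : SigmaExt k} (x : ι → K) (f : SigmaPoly ι k) (j : ℕ) :
    eval x ((shift : SigmaPoly ι k →+* SigmaPoly ι k)^[j] f) = (shift : K →+* K)^[j] (eval x f) := by
  induction j with
  | zero => rfl
  | succ j ih => rw [Function.iterate_succ_apply', Function.iterate_succ_apply', eval_shift, ih]

/-- Substitution of `σ`-polynomials for the `σ`-indeterminates. -/
noncomputable def subst {ι κ : Type} (Q : κ → SigmaPoly ι k) : SigmaPoly κ k →ₐ[k] SigmaPoly ι k :=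
  MvPolynomial.aeval fun p => (shift : SigmaPoly ι k →+* SigmaPoly ι k)^[p.2] (Q p.1)

theorem eval_subst {ι κ : Type} {K : SigmaExt k} (x : ι → K) (Q : κ → SigmaPoly ι k)
    (f : SigmaPoly κ k) : eval x (subst Q f) = eval (fun i => eval x (Q i)) f := by
  have h : (eval x).comp (subst Q) = eval (fun i => eval x (Q i)) := by
    refine MvPolynomial.algHom_ext fun p => ?_
    rw [AlgHom.comp_apply, subst, MvPolynomial.aeval_X, eval_iterate_shift, eval_X]
  exact DFunLike.congr_fun h f

theorem eval_X_zero {ι : Type} {K : SigmaExt k} (x : ι → K) (i : ι) :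
    eval x (MvPolynomial.X (i, 0)) = x i := eval_X x (i, 0)

/-- Evaluation commutes with an extension of `σ`-fields. -/
theorem eval_map {ι : Type} {K L : SigmaExt k} (φ : K →ₐ[k] L)
    (hφ : ∀ a, φ (shift a) = shift (φ a)) (x : ι → K) (f : SigmaPoly ι k) :
    eval (fun i => φ (x i)) f = φ (eval x f) := by
  have h : eval (fun i => φ (x i)) = φ.comp (eval x) := by
    refine MvPolynomial.algHom_ext fun p => ?_
    rw [AlgHom.comp_apply, eval_X, eval_X]
    exact ((Function.Semiconj.iterate_right hφ p.2).eq (x p.1)).symm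
  exact DFunLike.congr_fun h f

end SigmaPoly

/-! ### Cohn closures and density. -/

namespace SigmaVariety

open SigmaPoly

theorem mem_pts_iff (Y : SigmaVariety k) {K : SigmaExt k} (y : Y.ι → K) :
    y ∈ Y.pts K ↔ ∀ f ∈ vanishingIdeal Y.pts, eval y f = 0 := by
  refine ⟨fun hy f hf => hf K y hy, fun h => ?_⟩
  obtain ⟨F, hF⟩ := Y.exists_eq
  rw [hF]
  intro f hf
  refine h f fun L z hz => ?_
  rw [hF] at hz
  exact hz f hf

theorem subset_cohnClosure {ι : Type} [Finite ι] (W : PointFamily k ι) {K : SigmaExt k}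
    {y : ι → K} (hy : y ∈ W K) : y ∈ (cohnClosure W).pts K := fun _ hf => hf K y hy

/-- A polynomial map that sends `W` into the variety `Y` sends the closure of `W` into `Y`. -/
theorem eval_mem_of_mem_cohnClosure {ι : Type} [Finite ι] {W : PointFamily k ι}
    (Y : SigmaVariety k) (P : Y.ι → SigmaPoly ι k)
    (hP : ∀ (K : SigmaExt k), ∀ x ∈ W K, (fun i => eval x (P i)) ∈ Y.pts K)
    {K : SigmaExt k} {x : ι → K} (hx : x ∈ (cohnClosure W).pts K) :
    (fun i => eval x (P i)) ∈ Y.pts K := by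
  rw [mem_pts_iff]
  intro f hf
  rw [← eval_subst]
  refine hx _ fun L y hy => ?_
  rw [eval_subst]
  exact hf L _ (hP L y hy)

/-- Two `σ`-polynomials that agree on `W` agree on its closure. -/
theorem eval_eq_of_mem_cohnClosure {ι : Type} [Finite ι] {W : PointFamily k ι}
    {f g : SigmaPoly ι k} (h : ∀ (K : SigmaExt k), ∀ x ∈ W K, eval x f = eval x g)
    {K : SigmaExt k} {x : ι → K} (hx : x ∈ (cohnClosure W).pts K) : eval x f = eval x g := by
  rw [← sub_eq_zero, ← map_sub]
  refine hx _ fun L y hy => ?_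
  rw [map_sub, h L y hy, sub_self]

/-- The morphism given by `σ`-polynomials. -/
noncomputable def Hom.ofPoly {X Y : SigmaVariety k} (P : Y.ι → SigmaPoly X.ι k)
    (hP : ∀ (K : SigmaExt k), ∀ x ∈ X.pts K, (fun i => eval x (P i)) ∈ Y.pts K) : Hom X Y where
  map := fun x => ⟨fun i => eval x.1 (P i), hP _ x.1 x.2⟩
  exists_poly := ⟨P, fun _ _ _ => rfl⟩

/-- A `σ`-polynomial that vanishes on the image of a morphism with dense image vanishes on the
whole variety. -/
theorem mem_vanishingIdeal_of_dense {T X : SigmaVariety k} {j : Hom T X} (hj : Dense j.image)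
    {f : SigmaPoly X.ι k} (hf : ∀ (K : SigmaExt k) (t : T.pts K), eval (j.map t).1 f = 0) :
    f ∈ vanishingIdeal X.pts := by
  intro K x hx
  have hcl : IsClosed {p : SigmaSpec X.CoordRing |
      Ideal.Quotient.mk (vanishingIdeal X.pts) f ∈ p.1.asIdeal} := by
    have := (PrimeSpectrum.isClosed_zeroLocus
      {Ideal.Quotient.mk (vanishingIdeal X.pts) f}).preimage
        (continuous_subtype_val (p := fun p : PrimeSpectrum X.CoordRing =>
          ∀ a, shift a ∈ p.asIdeal ↔ a ∈ p.asIdeal))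
    convert this using 1
    ext p
    simp [PrimeSpectrum.mem_zeroLocus]
  have hsub : j.image ⊆ {p : SigmaSpec X.CoordRing |
      Ideal.Quotient.mk (vanishingIdeal X.pts) f ∈ p.1.asIdeal} := by
    rintro _ ⟨L, t, rfl⟩
    exact hf L t
  have := (hcl.closure_subset_iff.2 hsub) (hj (X.toSpec ⟨x, hx⟩))
  exact this

/-- The closure of the image is a zero locus. A function in its defining set vanishes on the image,
so it is zero in `k{X}` and lies in every prime. -/
theorem dense_image_of {T X : SigmaVariety k} {j : Hom T X}
    (h : ∀ f : SigmaPoly X.ι k, (∀ (K : SigmaExt k) (t : T.pts K), eval (j.map t).1 f = 0) →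
      f ∈ vanishingIdeal X.pts) : Dense j.image := by
  rw [dense_iff_closure_eq, Set.eq_univ_iff_forall]
  intro p
  obtain ⟨Z, hZ, hZe⟩ := isClosed_induced_iff.1 (isClosed_closure (s := j.image))
  obtain ⟨s, rfl⟩ := (PrimeSpectrum.isClosed_iff_zeroLocus Z).1 hZ
  rw [← hZe]
  intro g hg
  obtain ⟨f, rfl⟩ := Ideal.Quotient.mk_surjective g
  have hf : Ideal.Quotient.mk (vanishingIdeal X.pts) f = 0 := by
    refine Ideal.Quotient.eq_zero_iff_mem.2 (h f fun K t => ?_)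
    have ht : X.toSpec (j.map t) ∈ closure j.image := subset_closure ⟨K, t, rfl⟩
    rw [← hZe] at ht
    exact ht hg
  rw [hf]
  exact zero_mem _

end SigmaVariety

end Evaluation

/-! ### Laurent `σ`-monomials. -/

section Monomials

open Polynomial

theorem iterate_shift_ne_zero {K : Type u} [Field K] [DifferenceRing K] {a : K} (ha : a ≠ 0)
    (i : ℕ) : (shift : K →+* K)^[i] a ≠ 0 := by
  induction i with
  | zero => exact ha
  | succ i ih =>
    rw [Function.iterate_succ_apply']
    exact (_root_.map_ne_zero _).2 ih

/-- Allows powers with different supports to be compared over a common index set. -/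
theorem sigmaPow_eq_prod {K : Type u} [Field K] [DifferenceRing K] (a : K) {p : ℤ[X]}
    {s : Finset ℕ} (hs : p.support ⊆ s) :
    sigmaPow a p = ∏ i ∈ s, ((shift : K →+* K)^[i] a) ^ (p.coeff i) := by
  refine Finset.prod_subset hs fun i _ hi => ?_
  rw [notMem_support_iff.1 hi, zpow_zero]

theorem sigmaPow_zero {K : Type u} [Field K] [DifferenceRing K] (a : K) : sigmaPow a 0 = 1 := by
  simp [sigmaPow]

theorem sigmaPow_add {K : Type u} [Field K] [DifferenceRing K] {a : K} (ha : a ≠ 0) (p q : ℤ[X]) :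
    sigmaPow a (p + q) = sigmaPow a p * sigmaPow a q := by
  classical
  rw [sigmaPow_eq_prod a (support_add (p := p) (q := q)),
    sigmaPow_eq_prod a (Finset.subset_union_left (s₁ := p.support) (s₂ := q.support)),
    sigmaPow_eq_prod a (Finset.subset_union_right (s₁ := p.support) (s₂ := q.support)),
    ← Finset.prod_mul_distrib]
  refine Finset.prod_congr rfl fun i _ => ?_
  rw [coeff_add, zpow_add₀ (iterate_shift_ne_zero ha i)]

theorem sigmaPow_neg {K : Type u} [Field K] [DifferenceRing K] (a : K) (p : ℤ[X]) :
    sigmaPow a (-p) = (sigmaPow a p)⁻¹ := by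
  rw [sigmaPow, sigmaPow, support_neg, ← Finset.prod_inv_distrib]
  refine Finset.prod_congr rfl fun i _ => ?_
  rw [coeff_neg, zpow_neg]

theorem sigmaPow_mul_left {K : Type u} [Field K] [DifferenceRing K] (a b : K) (p : ℤ[X]) :
    sigmaPow (a * b) p = sigmaPow a p * sigmaPow b p := by
  rw [sigmaPow, sigmaPow, sigmaPow, ← Finset.prod_mul_distrib]
  refine Finset.prod_congr rfl fun i _ => ?_
  rw [iterate_map_mul, mul_zpow]

theorem sigmaPow_ne_zero {K : Type u} [Field K] [DifferenceRing K] {a : K} (ha : a ≠ 0)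
    (p : ℤ[X]) : sigmaPow a p ≠ 0 :=
  Finset.prod_ne_zero_iff.2 fun i _ => zpow_ne_zero _ (iterate_shift_ne_zero ha i)

theorem sigmaPow_X_mul {K : Type u} [Field K] [DifferenceRing K] (a : K) (p : ℤ[X]) :
    sigmaPow a (X * p) = shift (sigmaPow a p) := by
  have h : (X * p).support ⊆ p.support.map ⟨Nat.succ, Nat.succ_injective⟩ := by
    intro i hi
    rw [mem_support_iff] at hi
    cases i with
    | zero => simp at hi
    | succ i =>
      rw [coeff_X_mul] at hi
      simpa using hi
  rw [sigmaPow_eq_prod a h, Finset.prod_map, sigmaPow, map_prod]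
  refine Finset.prod_congr rfl fun i _ => ?_
  rw [map_zpow₀]
  simp only [Function.Embedding.coeFn_mk, Nat.succ_eq_add_one, coeff_X_mul,
    Function.iterate_succ_apply']

theorem map_sigmaPow {K L : Type u} [Field K] [DifferenceRing K] [Field L] [DifferenceRing L]
    (φ : K →+* L) (hφ : ∀ a, φ (shift a) = shift (φ a)) (a : K) (p : ℤ[X]) :
    φ (sigmaPow a p) = sigmaPow (φ a) p := by
  rw [sigmaPow, sigmaPow, map_prod]
  refine Finset.prod_congr rfl fun i _ => ?_
  rw [map_zpow₀, (Function.Semiconj.iterate_right hφ i).eq]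

section Laurent

variable {K : Type u} [Field K] [DifferenceRing K] {n : ℕ}

theorem laurentMonomial_zero (t : Fin n → K) : laurentMonomial t 0 = 1 :=
  Finset.prod_eq_one fun _ _ => sigmaPow_zero _

theorem laurentMonomial_add {t : Fin n → K} (ht : ∀ i, t i ≠ 0) (v w : Fin n → ℤ[X]) :
    laurentMonomial t (v + w) = laurentMonomial t v * laurentMonomial t w := by
  rw [laurentMonomial, laurentMonomial, laurentMonomial, ← Finset.prod_mul_distrib]
  exact Finset.prod_congr rfl fun i _ => sigmaPow_add (ht i) _ _

theorem laurentMonomial_neg (t : Fin n → K) (v : Fin n → ℤ[X]) :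
    laurentMonomial t (-v) = (laurentMonomial t v)⁻¹ := by
  rw [laurentMonomial, laurentMonomial, ← Finset.prod_inv_distrib]
  exact Finset.prod_congr rfl fun i _ => sigmaPow_neg _ _

theorem laurentMonomial_mul_left (s t : Fin n → K) (v : Fin n → ℤ[X]) :
    laurentMonomial (s * t) v = laurentMonomial s v * laurentMonomial t v := by
  rw [laurentMonomial, laurentMonomial, laurentMonomial, ← Finset.prod_mul_distrib]
  exact Finset.prod_congr rfl fun i _ => sigmaPow_mul_left _ _ _

theorem laurentMonomial_one_left (v : Fin n → ℤ[X]) : laurentMonomial (1 : Fin n → K) v = 1 := by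
  refine Finset.prod_eq_one fun i _ => Finset.prod_eq_one fun j _ => ?_
  rw [Pi.one_apply, iterate_map_one, one_zpow]

theorem laurentMonomial_inv_left (t : Fin n → K) (v : Fin n → ℤ[X]) :
    laurentMonomial t⁻¹ v = (laurentMonomial t v)⁻¹ := by
  rw [laurentMonomial, laurentMonomial, ← Finset.prod_inv_distrib]
  refine Finset.prod_congr rfl fun i _ => ?_
  rw [sigmaPow, sigmaPow, ← Finset.prod_inv_distrib]
  refine Finset.prod_congr rfl fun j _ => ?_
  rw [Pi.inv_apply, ← inv_zpow]
  congr 1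
  exact ((Function.Semiconj.iterate_right (f := fun a : K => a⁻¹)
    (fun a => (map_inv₀ _ a).symm) j).eq _).symm

theorem laurentMonomial_ne_zero {t : Fin n → K} (ht : ∀ i, t i ≠ 0) (v : Fin n → ℤ[X]) :
    laurentMonomial t v ≠ 0 :=
  Finset.prod_ne_zero_iff.2 fun i _ => sigmaPow_ne_zero (ht i) _

theorem laurentMonomial_X_smul (t : Fin n → K) (v : Fin n → ℤ[X]) :
    laurentMonomial t ((X : ℤ[X]) • v) = shift (laurentMonomial t v) := by
  rw [laurentMonomial, laurentMonomial, map_prod]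
  exact Finset.prod_congr rfl fun i _ => sigmaPow_X_mul _ _

theorem laurentMonomial_X_pow_smul (t : Fin n → K) (v : Fin n → ℤ[X]) (j : ℕ) :
    laurentMonomial t ((X ^ j : ℤ[X]) • v) = (shift : K →+* K)^[j] (laurentMonomial t v) := by
  induction j with
  | zero => rw [pow_zero, one_smul, Function.iterate_zero_apply]
  | succ j ih =>
    rw [pow_succ', mul_smul, laurentMonomial_X_smul, ih, Function.iterate_succ_apply']

theorem map_laurentMonomial {L : Type u} [Field L] [DifferenceRing L] (φ : K →+* L)
    (hφ : ∀ a, φ (shift a) = shift (φ a)) (t : Fin n → K) (v : Fin n → ℤ[X]) :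
    φ (laurentMonomial t v) = laurentMonomial (fun i => φ (t i)) v := by
  rw [laurentMonomial, laurentMonomial, map_prod]
  exact Finset.prod_congr rfl fun i _ => map_sigmaPow φ hφ _ _

/-- A character `χ` of `ℤ[x]^n` that is compatible with `σ` is the evaluation of the Laurent
monomials at a point. -/
theorem laurentMonomial_of_character (χ : Multiplicative (Fin n → ℤ[X]) →* K)
    (hχ : ∀ w : Fin n → ℤ[X], χ (.ofAdd ((X : ℤ[X]) • w)) = shift (χ (.ofAdd w)))
    (w : Fin n → ℤ[X]) :
    laurentMonomial (fun i => χ (.ofAdd (Pi.single i 1))) w = χ (.ofAdd w) := by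
  have hpow : ∀ (j : ℕ) (v : Fin n → ℤ[X]),
      χ (.ofAdd ((X ^ j : ℤ[X]) • v)) = (shift : K →+* K)^[j] (χ (.ofAdd v)) := by
    intro j v
    induction j with
    | zero => rw [pow_zero, one_smul, Function.iterate_zero_apply]
    | succ j ih => rw [pow_succ', mul_smul, hχ, ih, Function.iterate_succ_apply']
  have hz : ∀ (c : ℤ) (v : Multiplicative (Fin n → ℤ[X])), χ (v ^ c) = χ v ^ c := by
    intro c v
    simp
  -- The elements `X ^ j • e_i` generate `ℤ[x]^n` as an additive group, and on them `χ` is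
  -- determined by `hpow`.
  have hsum : w = ∑ i, ∑ j ∈ (w i).support, ((w i).coeff j) • ((X ^ j : ℤ[X]) •
      (Pi.single i 1 : Fin n → ℤ[X])) := by
    ext1 l
    rw [Finset.sum_apply, Finset.sum_eq_single l]
    · conv_lhs => rw [(w l).as_sum_support]
      rw [Finset.sum_apply]
      refine Finset.sum_congr rfl fun j _ => ?_
      simp [← C_mul_X_pow_eq_monomial]
    · intro i _ hi
      rw [Finset.sum_apply]
      refine Finset.sum_eq_zero fun j _ => ?_
      simp [Pi.single_eq_of_ne hi.symm]
    · simp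
  conv_rhs => rw [hsum]
  rw [ofAdd_sum, map_prod]
  refine Finset.prod_congr rfl fun i _ => ?_
  rw [ofAdd_sum, map_prod]
  refine Finset.prod_congr rfl fun j _ => ?_
  rw [ofAdd_zsmul, hz, hpow]

end Laurent

end Monomials

/-! ### Generic points and expansions in Laurent monomials. -/

section Generic

open Polynomial

variable {k : Type u} [Field k] [DifferenceRing k]

/-- The fraction field of a domain with an injective endomorphism, as a `σ`-field extension. -/
noncomputable def SigmaExt.ofDomain (D : Type u) [CommRing D] [IsDomain D] [Algebra k D]
    (s : D →+* D) (hs : Function.Injective s)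
    (hk : ∀ a : k, s (algebraMap k D a) = algebraMap k D (shift a)) : SigmaExt k where
  carrier := FractionRing D
  diff := ⟨IsFractionRing.map (K := FractionRing D) (L := FractionRing D) hs⟩
  shift_algebraMap := fun a => by
    change IsFractionRing.map hs _ = _
    rw [IsScalarTower.algebraMap_apply k D (FractionRing D), IsFractionRing.map,
      IsLocalization.map_eq, hk, ← IsScalarTower.algebraMap_apply]

/-- The inclusion of a domain into the `σ`-field of its fractions. -/
noncomputable def SigmaExt.ofDomainMap {D : Type u} [CommRing D] [IsDomain D] [Algebra k D]
    (s : D →+* D) (hs : Function.Injective s)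
    (hk : ∀ a : k, s (algebraMap k D a) = algebraMap k D (shift a)) :
    D →ₐ[k] SigmaExt.ofDomain D s hs hk :=
  IsScalarTower.toAlgHom k D (FractionRing D)

theorem SigmaExt.ofDomainMap_injective {D : Type u} [CommRing D] [IsDomain D] [Algebra k D]
    (s : D →+* D) (hs : Function.Injective s)
    (hk : ∀ a : k, s (algebraMap k D a) = algebraMap k D (shift a)) :
    Function.Injective (SigmaExt.ofDomainMap s hs hk) :=
  IsFractionRing.injective D (FractionRing D)

theorem SigmaExt.ofDomainMap_shift {D : Type u} [CommRing D] [IsDomain D] [Algebra k D]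
    (s : D →+* D) (hs : Function.Injective s)
    (hk : ∀ a : k, s (algebraMap k D a) = algebraMap k D (shift a)) (a : D) :
    SigmaExt.ofDomainMap s hs hk (s a) = shift (SigmaExt.ofDomainMap s hs hk a) :=
  (IsLocalization.map_eq (M := nonZeroDivisors D) (S := FractionRing D) (Q := FractionRing D)
    (nonZeroDivisors_le_comap_nonZeroDivisors_of_injective s hs) a).symm

/-- Makes the group algebra of `ℤ[x]^n` over a field a domain. Taking coefficients embeds `ℤ[x]^n`
in a power of `ℤ`. -/
instance uniqueSums_exponents (n : ℕ) : UniqueSums (Fin n → ℤ[X]) := by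
  let f : AddHom (Fin n → ℤ[X]) (Fin n → ℕ → ℤ) :=
    ⟨fun w i j => (w i).coeff j, fun v w => by ext i j; simp⟩
  refine UniqueSums.of_injective_addHom f (fun v w h => ?_) inferInstance
  ext i j
  exact congrFun (congrFun h i) j

/-- `L` is the fraction field of the group algebra of `ℤ[x]^n` over `K`, with `σ` acting on
coefficients and multiplying exponents by `x`; this map is injective, so it extends to fractions. At
the tautological point `t` the monomial `t^w` is the basis element of `w`, whence the linear
independence. -/
theorem exists_generic (K : SigmaExt k) (n : ℕ) :
    ∃ (L : SigmaExt k) (φ : K →ₐ[k] L) (t : Fin n → L),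
      (∀ a, φ (shift a) = shift (φ a)) ∧ (∀ i, t i ≠ 0) ∧
      ∀ c : (Fin n → ℤ[X]) →₀ K, (c.sum fun w a => φ a * laurentMonomial t w) = 0 → c = 0 := by
  let D := AddMonoidAlgebra K (Fin n → ℤ[X])
  let mulX : (Fin n → ℤ[X]) →+ (Fin n → ℤ[X]) := DistribSMul.toAddMonoidHom _ (X : ℤ[X])
  have hmulX : Function.Injective mulX := by
    intro v w h
    ext1 i
    exact mul_left_cancel₀ X_ne_zero (congrFun h i)
  let s : D →+* D := (AddMonoidAlgebra.mapDomainRingHom K mulX).comp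
    (AddMonoidAlgebra.mapRingHom _ (shift : K →+* K))
  have hs_single : ∀ w a, s (.single w a) = .single ((X : ℤ[X]) • w) (shift a) := by
    intro w a
    rw [RingHom.comp_apply, AddMonoidAlgebra.mapRingHom_single]
    exact AddMonoidAlgebra.mapDomain_single
  have hs : Function.Injective s := by
    refine Function.Injective.comp (g := AddMonoidAlgebra.mapDomain mulX)
      (AddMonoidAlgebra.mapDomain_injective hmulX) ?_
    exact AddMonoidAlgebra.map_injective _ (shift : K →+* K).injective
  have hK : ∀ a : K, algebraMap K D a = .single 0 a := fun _ => rfl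
  have hsK : ∀ a : K, s (algebraMap K D a) = algebraMap K D (shift a) := by
    intro a
    rw [hK, hK, hs_single, smul_zero]
  have hk : ∀ a : k, s (algebraMap k D a) = algebraMap k D (shift a) := by
    intro a
    rw [IsScalarTower.algebraMap_apply k K D, hsK, K.shift_algebraMap,
      ← IsScalarTower.algebraMap_apply]
  let ι := SigmaExt.ofDomainMap s hs hk
  have hι := SigmaExt.ofDomainMap_shift s hs hk
  have hinj : Function.Injective ι := SigmaExt.ofDomainMap_injective s hs hk
  let χ : Multiplicative (Fin n → ℤ[X]) →* SigmaExt.ofDomain D s hs hk :=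
    ι.toRingHom.toMonoidHom.comp (AddMonoidAlgebra.of K _)
  have hχ1 : ∀ w, χ (.ofAdd w) = ι (.single w 1) := fun w => rfl
  have hχ : ∀ w : Fin n → ℤ[X], χ (.ofAdd ((X : ℤ[X]) • w)) = shift (χ (.ofAdd w)) := by
    intro w
    rw [hχ1, hχ1, ← hι, hs_single, map_one]
  refine ⟨SigmaExt.ofDomain D s hs hk, ι.comp (IsScalarTower.toAlgHom k K D),
    fun i => χ (.ofAdd (Pi.single i 1)), ?_, ?_, ?_⟩
  · intro a
    change ι (algebraMap K D _) = shift (ι (algebraMap K D a))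
    rw [← hsK, hι]
  · intro i h
    beta_reduce at h
    rw [hχ1, map_eq_zero_iff ι hinj, AddMonoidAlgebra.single_eq_zero] at h
    exact one_ne_zero h
  · intro c hc
    have h : ι (.ofCoeff c) = 0 := by
      rw [← hc, ← AddMonoidAlgebra.sum_coeff_single (.ofCoeff c), Finsupp.sum, map_sum]
      refine Finset.sum_congr rfl fun w _ => ?_
      beta_reduce
      rw [laurentMonomial_of_character χ hχ, hχ1]
      change _ = ι (algebraMap K D _) * _
      rw [← map_mul, hK, AddMonoidAlgebra.single_mul_single, zero_add, mul_one]
    rw [map_eq_zero_iff ι hinj] at h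
    exact congrArg AddMonoidAlgebra.coeff h

/-- A `σ`-polynomial evaluated at Laurent monomials in some of the variables is a combination of
Laurent monomials with `σ`-polynomials in the other variables as coefficients. -/
theorem exists_expansion {κ ι : Type} {n : ℕ} (U : κ → Fin n → ℤ[X])
    (g : SigmaPoly (κ ⊕ ι) k) :
    ∃ b : (Fin n → ℤ[X]) →₀ SigmaPoly ι k, ∀ (K : SigmaExt k) (t : Fin n → K) (x : ι → K),
      (∀ i, t i ≠ 0) →
      SigmaPoly.eval (Sum.elim (fun i => laurentMonomial t (U i)) x) g =
        b.sum fun w f => SigmaPoly.eval x f * laurentMonomial t w := by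
  induction g using MvPolynomial.induction_on with
  | C a =>
    refine ⟨Finsupp.single 0 (MvPolynomial.C a), fun K t x ht => ?_⟩
    rw [SigmaPoly.eval_C, Finsupp.sum_single_index, SigmaPoly.eval_C, laurentMonomial_zero,
      mul_one]
    rw [map_zero, zero_mul]
  | add p q hp hq =>
    obtain ⟨b, hb⟩ := hp
    obtain ⟨c, hc⟩ := hq
    refine ⟨b + c, fun K t x ht => ?_⟩
    rw [map_add, hb K t x ht, hc K t x ht, Finsupp.sum_add_index']
    · intro w
      rw [map_zero, zero_mul]
    · intro w f g
      rw [map_add, add_mul]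
  | mul_X p i hp =>
    obtain ⟨b, hb⟩ := hp
    obtain ⟨i | i, j⟩ := i
    -- A monomial variable stands for `σ^j(t^(U i))`, so it translates the exponents; in the other
    -- case the variable multiplies the coefficients.
    · refine ⟨b.mapDomain (· + (X ^ j : ℤ[X]) • U i), fun K t x ht => ?_⟩
      rw [map_mul, hb K t x ht, SigmaPoly.eval_X, Finsupp.sum_mapDomain_index, Finsupp.sum,
        Finset.sum_mul]
      · refine Finset.sum_congr rfl fun w _ => ?_
        beta_reduce
        rw [laurentMonomial_add ht, laurentMonomial_X_pow_smul, mul_assoc]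
        rfl
      · intro w
        rw [map_zero, zero_mul]
      · intro w f g
        rw [map_add, add_mul]
    · refine ⟨b.mapRange (· * MvPolynomial.X (i, j)) (zero_mul _), fun K t x ht => ?_⟩
      rw [map_mul, hb K t x ht, SigmaPoly.eval_X, Finsupp.sum_mapRange_index, Finsupp.sum,
        Finset.sum_mul]
      · refine Finset.sum_congr rfl fun w _ => ?_
        beta_reduce
        rw [map_mul, SigmaPoly.eval_X, mul_right_comm]
        rfl
      · intro w
        rw [map_zero, zero_mul]

theorem exists_expansion_scalar {κ : Type} {n : ℕ} (U : κ → Fin n → ℤ[X]) (g : SigmaPoly κ k) :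
    ∃ c : (Fin n → ℤ[X]) →₀ k, ∀ (K : SigmaExt k) (t : Fin n → K), (∀ i, t i ≠ 0) →
      SigmaPoly.eval (fun i => laurentMonomial t (U i)) g =
        c.sum fun w a => algebraMap k K a * laurentMonomial t w := by
  -- With an empty set of remaining variables the coefficients are constants.
  obtain ⟨b, hb⟩ := exists_expansion U
    (MvPolynomial.rename (Prod.map (Sum.inl : κ → κ ⊕ Empty) id) g)
  refine ⟨b.mapRange MvPolynomial.constantCoeff (map_zero _), fun K t ht => ?_⟩
  have h := hb K t Empty.elim ht
  rw [SigmaVariety.eval_rename, Sum.elim_comp_inl] at h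
  rw [h, Finsupp.sum_mapRange_index]
  · refine Finset.sum_congr rfl fun w _ => ?_
    beta_reduce
    congr 1
    conv_lhs => rw [MvPolynomial.eq_C_of_isEmpty (b w)]
    rw [SigmaPoly.eval_C, MvPolynomial.constantCoeff_eq]
  · intro w
    rw [map_zero, zero_mul]

end Generic

/-! ### Operations on morphisms, and points of the Cohn spectrum. -/

section Morphisms

variable {k : Type u} [Field k] [DifferenceRing k]

namespace SigmaVariety

open SigmaPoly

theorem Hom.eval_map {X Y : SigmaVariety k} (f : Hom X Y) :
    ∃ P : Y.ι → SigmaPoly X.ι k, (∀ (K : SigmaExt k) (x : X.pts K) (i : Y.ι),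
      (f.map x).1 i = eval x.1 (P i)) ∧ ∀ (K : SigmaExt k) (x : X.pts K) (g : SigmaPoly Y.ι k),
        eval (f.map x).1 g = eval x.1 (subst P g) := by
  obtain ⟨P, hP⟩ := f.exists_poly
  refine ⟨P, hP, fun K x g => ?_⟩
  rw [eval_subst]
  congr 2
  exact funext (hP K x)

/-- The composition of morphisms. -/
def Hom.comp {X Y Z : SigmaVariety k} (g : Hom Y Z) (f : Hom X Y) : Hom X Z where
  map := fun x => g.map (f.map x)
  exists_poly := by
    obtain ⟨P, -, hP⟩ := f.eval_map
    obtain ⟨Q, hQ⟩ := g.exists_poly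
    exact ⟨fun i => subst P (Q i), fun K x i => by rw [hQ, hP]⟩

/-- The first projection. -/
def Hom.fst (X Y : SigmaVariety k) : Hom (X.prod Y) X where
  map := fun z => ⟨z.1 ∘ Sum.inl, z.2.1⟩
  exists_poly := ⟨fun i => MvPolynomial.X (Sum.inl i, 0), fun _ z _ => (eval_X_zero z.1 _).symm⟩

/-- The second projection. -/
def Hom.snd (X Y : SigmaVariety k) : Hom (X.prod Y) Y where
  map := fun z => ⟨z.1 ∘ Sum.inr, z.2.2⟩
  exists_poly := ⟨fun i => MvPolynomial.X (Sum.inr i, 0), fun _ z _ => (eval_X_zero z.1 _).symm⟩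

/-- The morphism to a product given by its two components. -/
def Hom.lift {X Y Z : SigmaVariety k} (f : Hom Z X) (g : Hom Z Y) : Hom Z (X.prod Y) where
  map := fun z => pair (f.map z) (g.map z)
  exists_poly := by
    obtain ⟨P, hP⟩ := f.exists_poly
    obtain ⟨Q, hQ⟩ := g.exists_poly
    refine ⟨Sum.elim P Q, fun K z i => ?_⟩
    cases i with
    | inl i => exact hP K z i
    | inr i => exact hQ K z i

theorem iterate_shift_X {ι : Type} (i : ι) (j : ℕ) :
    (shift : SigmaPoly ι k →+* SigmaPoly ι k)^[j] (MvPolynomial.X (i, 0)) =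
      MvPolynomial.X (i, j) := by
  induction j with
  | zero => rfl
  | succ j ih =>
    rw [Function.iterate_succ_apply', ih]
    exact MvPolynomial.eval₂Hom_X' _ _ _

/-- Homomorphisms to `K` that commute with `σ` are evaluations. -/
theorem eq_eval_of_comm {ι : Type} {K : SigmaExt k} (ψ : SigmaPoly ι k →ₐ[k] K)
    (hψ : ∀ f, ψ (shift f) = shift (ψ f)) :
    ψ = eval (fun i => ψ (MvPolynomial.X (i, 0))) := by
  refine MvPolynomial.algHom_ext fun p => ?_
  rw [eval_X, ← (Function.Semiconj.iterate_right hψ p.2).eq, iterate_shift_X]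

theorem mk_mem_toSpec_iff (X : SigmaVariety k) {K : SigmaExt k} (x : X.pts K)
    (f : SigmaPoly X.ι k) :
    Ideal.Quotient.mk (vanishingIdeal X.pts) f ∈ (X.toSpec x).1.asIdeal ↔ eval x.1 f = 0 :=
  Iff.rfl

/-- Every element of `Spec^σ(k{X})` is given by a point of `X`. -/
theorem exists_eq_toSpec (X : SigmaVariety k) (p : SigmaSpec X.CoordRing) :
    ∃ (K : SigmaExt k) (x : X.pts K), p = X.toSpec x := by
  -- The point is the generic point of `p`, with values in the fraction field of the residue domain.
  -- One half of the `σ`-prime condition makes `σ` descend, the other makes it injective.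
  let s : X.CoordRing ⧸ p.1.asIdeal →+* X.CoordRing ⧸ p.1.asIdeal :=
    Ideal.quotientMap p.1.asIdeal shift (fun a ha => (p.2 a).2 ha)
  have hs : Function.Injective s := Ideal.quotientMap_injective' (fun a ha => (p.2 a).1 ha)
  have hmk : ∀ f : SigmaPoly X.ι k, s (Ideal.Quotient.mk _ (Ideal.Quotient.mk _ f)) =
      Ideal.Quotient.mk _ (Ideal.Quotient.mk _ (shift f)) := fun f => rfl
  have hk : ∀ a : k, s (algebraMap k _ a) = algebraMap k _ (shift a) := by
    intro a
    have h : (shift : SigmaPoly X.ι k →+* SigmaPoly X.ι k) (MvPolynomial.C a) =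
        MvPolynomial.C (shift a) := MvPolynomial.eval₂Hom_C _ _ _
    exact (hmk (MvPolynomial.C a)).trans (by rw [h]; rfl)
  let ψ : SigmaPoly X.ι k →ₐ[k] SigmaExt.ofDomain _ s hs hk :=
    (SigmaExt.ofDomainMap s hs hk).comp
      ((Ideal.Quotient.mkₐ k p.1.asIdeal).comp (Ideal.Quotient.mkₐ k (vanishingIdeal X.pts)))
  have hψ : ∀ f, ψ (shift f) = shift (ψ f) := fun f =>
    (congrArg _ (hmk f).symm).trans (SigmaExt.ofDomainMap_shift s hs hk _)
  have hψ0 : ∀ f, ψ f = 0 ↔ Ideal.Quotient.mk (vanishingIdeal X.pts) f ∈ p.1.asIdeal := by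
    intro f
    rw [← Ideal.Quotient.eq_zero_iff_mem]
    exact map_eq_zero_iff _ (SigmaExt.ofDomainMap_injective s hs hk)
  have hx : (fun i => ψ (MvPolynomial.X (i, 0))) ∈ X.pts (SigmaExt.ofDomain _ s hs hk) := by
    rw [mem_pts_iff]
    intro f hf
    rw [← eq_eval_of_comm ψ hψ, hψ0, Ideal.Quotient.eq_zero_iff_mem.2 hf]
    exact zero_mem _
  refine ⟨_, ⟨_, hx⟩, ?_⟩
  ext a
  obtain ⟨f, rfl⟩ := Ideal.Quotient.mk_surjective a
  rw [← hψ0, mk_mem_toSpec_iff]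
  exact iff_of_eq (congrArg (· = 0) (DFunLike.congr_fun (eq_eval_of_comm ψ hψ) f))

end SigmaVariety

end Morphisms

/-! ### Closures of monomial maps and their binomial equations. -/

section MonomialFamily

open scoped Polynomial
open Polynomial (X)
open SigmaPoly SigmaVariety

variable {k : Type u} [Field k] [DifferenceRing k]

/-- The Laurent monomials at a point, as a character of `ℤ[x]^n`. -/
noncomputable def laurentHom {K : Type u} [Field K] [DifferenceRing K] {n : ℕ} (t : Fin n → K)
    (ht : ∀ i, t i ≠ 0) : Multiplicative (Fin n → ℤ[X]) →* K where
  toFun := fun w => laurentMonomial t w.toAdd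
  map_one' := laurentMonomial_zero t
  map_mul' := fun v w => laurentMonomial_add ht v.toAdd w.toAdd

variable (k) in
/-- The image of `t ↦ (t^(u_i))_i`, for an arbitrary index type. -/
def monomialFamily {ι : Type} {n : ℕ} (U : ι → Fin n → ℤ[X]) : PointFamily k ι :=
  fun K => {y | ∃ t : Fin n → K, (∀ i, t i ≠ 0) ∧ y = fun j => laurentMonomial t (U j)}

/-- The exponent of the Laurent monomial obtained by substituting `t^(u_i)` for `y_i` in a
`σ`-monomial. -/
noncomputable def exponent {ι : Type} {n : ℕ} (U : ι → Fin n → ℤ[X]) (a : ι × ℕ →₀ ℕ) :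
    Fin n → ℤ[X] :=
  a.sum fun p c => c • ((X ^ p.2 : ℤ[X]) • U p.1)

theorem eval_monomial_laurent {ι : Type} {n : ℕ} (U : ι → Fin n → ℤ[X]) {K : SigmaExt k}
    {t : Fin n → K} (ht : ∀ i, t i ≠ 0) (a : ι × ℕ →₀ ℕ) :
    eval (fun j => laurentMonomial t (U j)) (MvPolynomial.monomial a 1) =
      laurentMonomial t (exponent U a) := by
  change _ = laurentHom t ht (.ofAdd (∑ p ∈ a.support, a p • ((X ^ p.2 : ℤ[X]) • U p.1)))
  rw [ofAdd_sum, map_prod, eval, MvPolynomial.aeval_monomial, map_one,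
    one_mul]
  refine Finset.prod_congr rfl fun p _ => ?_
  beta_reduce
  rw [ofAdd_nsmul, map_pow, ← laurentMonomial_X_pow_smul]
  rfl

/-- The base field as an extension of itself. -/
noncomputable def SigmaExt.base (k : Type u) [Field k] [DifferenceRing k] : SigmaExt k where
  carrier := k
  shift_algebraMap := fun _ => rfl

theorem exists_generic_base (n : ℕ) :
    ∃ (L : SigmaExt k) (t : Fin n → L), (∀ i, t i ≠ 0) ∧ ∀ c : (Fin n → ℤ[X]) →₀ k,
      (c.sum fun w a => algebraMap k L a * laurentMonomial t w) = 0 → c = 0 := by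
  obtain ⟨L, φ, t, -, ht, hli⟩ := exists_generic (SigmaExt.base k) n
  refine ⟨L, t, ht, fun c hc => hli c (Eq.trans ?_ hc)⟩
  refine Finset.sum_congr rfl fun w _ => ?_
  exact congrArg (· * laurentMonomial t w) (φ.commutes (c w))

theorem eval_eq_sum {ι : Type} {K : SigmaExt k} (x : ι → K) (f : SigmaPoly ι k) :
    eval x f = ∑ a ∈ f.support, algebraMap k K (f.coeff a) *
      eval x (MvPolynomial.monomial a 1) := by
  conv_lhs => rw [f.as_sum, map_sum]
  refine Finset.sum_congr rfl fun a _ => ?_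
  rw [← eval_C x, ← map_mul, MvPolynomial.C_mul_monomial, mul_one]

/-- The closure of the image of a monomial map is defined by binomial equations. -/
theorem mem_cohnClosure_monomialFamily_iff {ι : Type} [Finite ι] {n : ℕ} (U : ι → Fin n → ℤ[X])
    {K : SigmaExt k} (x : ι → K) :
    x ∈ (cohnClosure (monomialFamily k U)).pts K ↔
      ∀ a b : ι × ℕ →₀ ℕ, exponent U a = exponent U b →
        eval x (MvPolynomial.monomial a 1) = eval x (MvPolynomial.monomial b 1) := by
  constructor
  · intro hx a b hab
    refine eval_eq_of_mem_cohnClosure ?_ hx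
    rintro L _ ⟨t, ht, rfl⟩
    rw [eval_monomial_laurent U ht, eval_monomial_laurent U ht, hab]
  · intro h f hf
    obtain ⟨L, t, ht, hli⟩ := exists_generic_base (k := k) n
    -- The terms of `f` are grouped by exponent; vanishing at a generic point kills each group's
    -- coefficient sum.
    let c : (Fin n → ℤ[X]) →₀ k := ∑ a ∈ f.support, Finsupp.single (exponent U a) (f.coeff a)
    have hc : c = 0 := by
      refine hli c ?_
      have h0 := hf L _ ⟨t, ht, rfl⟩
      rw [eval_eq_sum] at h0
      rw [← h0, ← Finsupp.sum_finsetSum_index]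
      · refine Finset.sum_congr rfl fun a _ => ?_
        rw [Finsupp.sum_single_index, eval_monomial_laurent U ht]
        · rw [map_zero, zero_mul]
      · intro w
        rw [map_zero, zero_mul]
      · intro w a b
        rw [map_add, add_mul]
    -- By the binomial equations the value of a monomial at `x` depends only on its exponent, so
    -- `f(x)` is a linear function of `c`. The default value `0` of the extension is never used.
    have hfac : Function.FactorsThrough
        (fun a : ι × ℕ →₀ ℕ => eval x (MvPolynomial.monomial a 1)) (exponent U) := h
    have hsum : eval x f = c.sum fun w a => algebraMap k K a *
        Function.extend (exponent U)
          (fun a : ι × ℕ →₀ ℕ => eval x (MvPolynomial.monomial a 1)) 0 w := by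
      rw [eval_eq_sum, ← Finsupp.sum_finsetSum_index]
      · refine Finset.sum_congr rfl fun a _ => ?_
        rw [Finsupp.sum_single_index, hfac.extend_apply]
        rw [map_zero, zero_mul]
      · intro w
        rw [map_zero, zero_mul]
      · intro w a b
        rw [map_add, add_mul]
    rw [hsum, hc, Finsupp.sum_zero_index]

theorem eval_monomial_mul {ι : Type} {K : SigmaExt k} (x y : ι → K) (a : ι × ℕ →₀ ℕ) :
    eval (x * y) (MvPolynomial.monomial a 1) =
      eval x (MvPolynomial.monomial a 1) * eval y (MvPolynomial.monomial a 1) := by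
  simp only [eval, MvPolynomial.aeval_monomial, map_one, one_mul, Pi.mul_apply, iterate_map_mul,
    mul_pow, Finsupp.prod_mul]

/-- Monomials are multiplicative, so binomial equations survive products. Both the group law of
`T_U` and its action on `X_U` come from this. -/
theorem mul_mem_cohnClosure {ι : Type} [Finite ι] {n : ℕ} {U : ι → Fin n → ℤ[X]}
    {K : SigmaExt k} {x y : ι → K} (hx : x ∈ (cohnClosure (monomialFamily k U)).pts K)
    (hy : y ∈ (cohnClosure (monomialFamily k U)).pts K) :
    x * y ∈ (cohnClosure (monomialFamily k U)).pts K := by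
  rw [mem_cohnClosure_monomialFamily_iff] at hx hy ⊢
  intro a b hab
  rw [eval_monomial_mul, eval_monomial_mul, hx a b hab, hy a b hab]

/-- The coefficients of an expansion in Laurent monomials are determined by its values. -/
theorem eval_coeff_of_expansion {ι : Type} {n : ℕ} {b : (Fin n → ℤ[X]) →₀ SigmaPoly ι k}
    {K : SigmaExt k} (x : ι → K) (c : (Fin n → ℤ[X]) →₀ K)
    (h : ∀ (L : SigmaExt k) (φ : K →ₐ[k] L) (t : Fin n → L), (∀ a, φ (shift a) = shift (φ a)) →
      (∀ i, t i ≠ 0) → (b.sum fun w f => eval (fun i => φ (x i)) f * laurentMonomial t w) =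
        c.sum fun w a => φ a * laurentMonomial t w) (w : Fin n → ℤ[X]) :
    eval x (b w) = c w := by
  obtain ⟨L, φ, t, hφ, ht, hli⟩ := exists_generic K n
  -- Both families have coefficients in `K` and the same sum at a point that is generic over `K`.
  have h0 : b.mapRange (eval x) (map_zero _) - c = 0 := by
    refine hli _ ?_
    rw [Finsupp.sum_sub_index, Finsupp.sum_mapRange_index, ← h L φ t hφ ht, sub_eq_zero]
    · refine Finset.sum_congr rfl fun v _ => ?_
      beta_reduce
      rw [eval_map φ hφ]
    · intro v
      rw [map_zero, zero_mul]
    · intro v a b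
      rw [map_sub, sub_mul]
  have := DFunLike.congr_fun (sub_eq_zero.1 h0) w
  rwa [Finsupp.mapRange_apply] at this

end MonomialFamily

/-! ### The group `T_U`, its inclusion in `X_U` and its action. -/

section Torus

open scoped Polynomial
open SigmaPoly SigmaVariety

variable {k : Type u} [Field k] [DifferenceRing k]

/-- Inverses of monomials are monomials with opposite exponents, so `T_U` also has a binomial
description. -/
theorem torusVariety_pts {n m : ℕ} (U : Fin m → Fin n → ℤ[X]) :
    (torusVariety k U).pts =
      (cohnClosure (monomialFamily k (Sum.elim U fun j => -U j))).pts := by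
  have h : (fun K : SigmaExt k => {z : Fin m ⊕ Fin m → K |
      ∃ y ∈ quasiTorus k U K, z = Sum.elim y (fun j => (y j)⁻¹)}) =
      monomialFamily k (Sum.elim U fun j => -U j) := by
    funext K
    have hz : ∀ t : Fin n → K, (Sum.elim (fun j => laurentMonomial t (U j))
        (fun j => (laurentMonomial t (U j))⁻¹) : Fin m ⊕ Fin m → K) =
        fun j => laurentMonomial t (Sum.elim U (fun j => -U j) j) := by
      intro t
      ext j
      cases j with
      | inl j => rfl
      | inr j => exact (laurentMonomial_neg t (U j)).symm
    ext z
    constructor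
    · rintro ⟨_, ⟨t, ht, rfl⟩, rfl⟩
      exact ⟨t, ht, hz t⟩
    · rintro ⟨t, ht, rfl⟩
      exact ⟨_, ⟨t, ht, rfl⟩, (hz t).symm⟩
  exact congrArg (fun W : PointFamily k (Fin m ⊕ Fin m) =>
    (zeroFamily (vanishingIdeal W : Set (SigmaPoly (Fin m ⊕ Fin m) k)) : PointFamily k _)) h

theorem laurent_mem_torusVariety {n m : ℕ} (U : Fin m → Fin n → ℤ[X]) {K : SigmaExt k}
    {t : Fin n → K} (ht : ∀ i, t i ≠ 0) :
    (fun j => laurentMonomial t (Sum.elim U (fun j => -U j) j)) ∈ (torusVariety k U).pts K := by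
  rw [torusVariety_pts]
  exact subset_cohnClosure _ ⟨t, ht, rfl⟩

theorem mul_mem_torusVariety {n m : ℕ} {U : Fin m → Fin n → ℤ[X]} {K : SigmaExt k}
    {x y : Fin m ⊕ Fin m → K} (hx : x ∈ (torusVariety k U).pts K)
    (hy : y ∈ (torusVariety k U).pts K) : x * y ∈ (torusVariety k U).pts K := by
  rw [torusVariety_pts] at *
  exact mul_mem_cohnClosure hx hy

theorem one_mem_torusVariety {n m : ℕ} (U : Fin m → Fin n → ℤ[X]) (K : SigmaExt k) :
    (1 : Fin m ⊕ Fin m → K) ∈ (torusVariety k U).pts K := by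
  have h := laurent_mem_torusVariety U (K := K) (t := 1) fun _ => one_ne_zero
  convert h using 1
  ext j
  exact (laurentMonomial_one_left _).symm

theorem torusVariety_mul_eq_one {n m : ℕ} {U : Fin m → Fin n → ℤ[X]} {K : SigmaExt k}
    {x : Fin m ⊕ Fin m → K} (hx : x ∈ (torusVariety k U).pts K) (i : Fin m) :
    x (Sum.inl i) * x (Sum.inr i) = 1 := by
  have h : eval x (MvPolynomial.X (Sum.inl i, 0) * MvPolynomial.X (Sum.inr i, 0)) = eval x 1 := by
    refine eval_eq_of_mem_cohnClosure ?_ hx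
    rintro L _ ⟨_, ⟨t, ht, rfl⟩, rfl⟩
    rw [map_mul, eval_X_zero, eval_X_zero, map_one]
    exact mul_inv_cancel₀ (laurentMonomial_ne_zero ht _)
  rwa [map_mul, eval_X_zero, eval_X_zero, map_one] at h

theorem torusVariety_ne_zero {n m : ℕ} {U : Fin m → Fin n → ℤ[X]} {K : SigmaExt k}
    {x : Fin m ⊕ Fin m → K} (hx : x ∈ (torusVariety k U).pts K) (i : Fin m) :
    x (Sum.inl i) ≠ 0 := left_ne_zero_of_mul_eq_one (torusVariety_mul_eq_one hx i)

theorem torusVariety_eq_elim {n m : ℕ} {U : Fin m → Fin n → ℤ[X]} {K : SigmaExt k}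
    {x : Fin m ⊕ Fin m → K} (hx : x ∈ (torusVariety k U).pts K) :
    x = Sum.elim (fun i => x (Sum.inl i)) (fun i => (x (Sum.inl i))⁻¹) := by
  ext i
  cases i with
  | inl i => rfl
  | inr i => exact eq_inv_of_mul_eq_one_right (torusVariety_mul_eq_one hx i)

/-- Inversion in `T_U` exchanges `y` and `y⁻¹`, hence is polynomial; on `T_U^*` it comes from `t ↦
t⁻¹`. -/
theorem swap_mem_torusVariety {n m : ℕ} {U : Fin m → Fin n → ℤ[X]} {K : SigmaExt k}
    {x : Fin m ⊕ Fin m → K} (hx : x ∈ (torusVariety k U).pts K) :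
    (fun i => x (Sum.swap i)) ∈ (torusVariety k U).pts K := by
  have h := eval_mem_of_mem_cohnClosure (torusVariety k U)
    (fun i => MvPolynomial.X (Sum.swap i, 0)) ?_ hx
  · exact (congrArg (· ∈ (torusVariety k U).pts K) (funext fun _ => eval_X_zero x _)).mp h
  rintro L _ ⟨_, ⟨t, ht, rfl⟩, rfl⟩
  refine subset_cohnClosure _ ⟨_, ⟨t⁻¹, fun i => inv_ne_zero (ht i), rfl⟩, ?_⟩
  funext i
  refine (eval_X_zero _ _).trans ?_
  cases i with
  | inl i => exact (laurentMonomial_inv_left t (U i)).symm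
  | inr i => exact (inv_eq_iff_eq_inv.2 (laurentMonomial_inv_left t (U i))).symm

theorem inl_mem_toricVariety {n m : ℕ} {U : Fin m → Fin n → ℤ[X]} {K : SigmaExt k}
    {x : Fin m ⊕ Fin m → K} (hx : x ∈ (torusVariety k U).pts K) :
    (fun i => x (Sum.inl i)) ∈ (toricVariety k U).pts K := by
  have h := eval_mem_of_mem_cohnClosure (toricVariety k U)
    (fun i => MvPolynomial.X (Sum.inl i, 0)) ?_ hx
  · exact (congrArg (· ∈ (toricVariety k U).pts K) (funext fun _ => eval_X_zero x _)).mp h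
  rintro L _ ⟨y, hy, rfl⟩
  exact subset_cohnClosure _
    ((congrArg (· ∈ quasiTorus k U L) (funext fun _ => eval_X_zero _ _)).mpr hy)

/-- A `σ`-polynomial in `y` and `y⁻¹` is a quotient of `σ`-polynomials in `y`, with a denominator
that is invertible wherever `y` is. -/
theorem exists_denominator {m : ℕ} (f : SigmaPoly (Fin m ⊕ Fin m) k) :
    ∃ a b : SigmaPoly (Fin m) k, ∀ (K : SigmaExt k) (y : Fin m → K), (∀ i, y i ≠ 0) →
      eval y b ≠ 0 ∧ eval y b * eval (Sum.elim y fun i => (y i)⁻¹) f = eval y a := by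
  induction f using MvPolynomial.induction_on with
  | C c =>
    refine ⟨MvPolynomial.C c, 1, fun K y _ => ?_⟩
    rw [map_one, one_mul, eval_C, eval_C]
    exact ⟨one_ne_zero, rfl⟩
  | add p q hp hq =>
    obtain ⟨a, b, h⟩ := hp
    obtain ⟨c, d, h'⟩ := hq
    refine ⟨a * d + c * b, b * d, fun K y hy => ?_⟩
    obtain ⟨h1, h2⟩ := h K y hy
    obtain ⟨h3, h4⟩ := h' K y hy
    simp only [map_mul, map_add, ← h2, ← h4]
    exact ⟨mul_ne_zero h1 h3, by ring⟩
  | mul_X p i hp =>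
    obtain ⟨a, b, h⟩ := hp
    obtain ⟨i | i, j⟩ := i
    · refine ⟨a * MvPolynomial.X (i, j), b, fun K y hy => ?_⟩
      obtain ⟨h1, h2⟩ := h K y hy
      simp only [map_mul, ← h2, eval_X, Sum.elim_inl]
      exact ⟨h1, by ring⟩
    · refine ⟨a, b * MvPolynomial.X (i, j), fun K y hy => ?_⟩
      obtain ⟨h1, h2⟩ := h K y hy
      have h3 : (shift : K →+* K)^[j] (y i) * (shift : K →+* K)^[j] (y i)⁻¹ = 1 := by
        rw [← iterate_map_mul, mul_inv_cancel₀ (hy i), iterate_map_one]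
      simp only [map_mul, ← h2, eval_X, Sum.elim_inr]
      refine ⟨mul_ne_zero h1 (left_ne_zero_of_mul_eq_one h3), ?_⟩
      rw [mul_mul_mul_comm, h3, mul_one]

/-- The points of `X_U` with nonzero coordinates are points of `T_U`. -/
theorem elim_mem_torusVariety {n m : ℕ} {U : Fin m → Fin n → ℤ[X]} {K : SigmaExt k}
    {y : Fin m → K} (hy : y ∈ (toricVariety k U).pts K) (h0 : ∀ i, y i ≠ 0) :
    Sum.elim y (fun i => (y i)⁻¹) ∈ (torusVariety k U).pts K := by
  intro f hf
  obtain ⟨a, b, h⟩ := exists_denominator f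
  -- The numerator of `f` vanishes on `T_U^*`, hence at `y`, where the denominator is nonzero.
  have ha : a ∈ vanishingIdeal (quasiTorus k U) := by
    rintro L _ ⟨t, ht, rfl⟩
    rw [← (h L _ fun i => laurentMonomial_ne_zero ht _).2, hf L _ ⟨_, ⟨t, ht, rfl⟩, rfl⟩, mul_zero]
  obtain ⟨hb, hab⟩ := h K y h0
  rw [hy a ha] at hab
  exact (mul_eq_zero.1 hab).resolve_left hb

theorem eval_X_mul_X {ι : Type} {K : SigmaExt k} (x : ι → K) (i j : ι) :
    eval x (MvPolynomial.X (i, 0) * MvPolynomial.X (j, 0)) = x i * x j := by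
  rw [map_mul, eval_X_zero, eval_X_zero]

variable (k) in
/-- The group structure of `T_U`: coordinatewise multiplication. -/
noncomputable def torusGroup {n m : ℕ} (U : Fin m → Fin n → ℤ[X]) :
    (torusVariety k U).GroupStructure where
  mul :=
    { map := fun z => ⟨(z.1 ∘ Sum.inl) * (z.1 ∘ Sum.inr), mul_mem_torusVariety z.2.1 z.2.2⟩
      exists_poly := ⟨fun i => MvPolynomial.X (Sum.inl i, 0) * MvPolynomial.X (Sum.inr i, 0),
        fun _ z i => (eval_X_mul_X z.1 (Sum.inl i) (Sum.inr i)).symm⟩ }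
  inv :=
    { map := fun z => ⟨fun i => z.1 (Sum.swap i), swap_mem_torusVariety z.2⟩
      exists_poly := ⟨fun i => MvPolynomial.X (Sum.swap i, 0),
        fun _ z _ => (eval_X_zero z.1 _).symm⟩ }
  one := fun K => ⟨1, one_mem_torusVariety U K⟩
  mul_assoc := fun _ a b c => Subtype.ext (mul_assoc a.1 b.1 c.1)
  one_mul := fun _ a => Subtype.ext (one_mul a.1)
  inv_mul_cancel := fun K a => by
    refine Subtype.ext (funext fun i => ?_)
    cases i with
    | inl i => exact (mul_comm _ _).trans (torusVariety_mul_eq_one a.2 i)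
    | inr i => exact torusVariety_mul_eq_one a.2 i

/-- The identity isomorphism. -/
def SigmaVariety.Iso.refl (X : SigmaVariety k) : Iso X X where
  hom := ⟨fun x => x, fun i => MvPolynomial.X (i, 0), fun _ x _ => (eval_X_zero x.1 _).symm⟩
  inv := ⟨fun x => x, fun i => MvPolynomial.X (i, 0), fun _ x _ => (eval_X_zero x.1 _).symm⟩
  inv_hom := fun _ _ => rfl
  hom_inv := fun _ _ => rfl

theorem torusGroup_isTorus {n m : ℕ} (U : Fin m → Fin n → ℤ[X]) : (torusGroup k U).IsTorus :=
  ⟨n, m, U, Iso.refl _, fun _ _ _ => rfl⟩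

variable (k) in
/-- The inclusion of `T_U` in `X_U`. -/
def torusInclusion {n m : ℕ} (U : Fin m → Fin n → ℤ[X]) :
    Hom (torusVariety k U) (toricVariety k U) where
  map := fun z => ⟨fun i => z.1 (Sum.inl i), inl_mem_toricVariety z.2⟩
  exists_poly := ⟨fun i => MvPolynomial.X (Sum.inl i, 0), fun _ z _ => (eval_X_zero z.1 _).symm⟩

theorem smul_mem_toricVariety {n m : ℕ} {U : Fin m → Fin n → ℤ[X]} {K : SigmaExt k}
    {t : Fin m ⊕ Fin m → K} {x : Fin m → K} (ht : t ∈ (torusVariety k U).pts K)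
    (hx : x ∈ (toricVariety k U).pts K) :
    (fun i => t (Sum.inl i) * x i) ∈ (toricVariety k U).pts K :=
  mul_mem_cohnClosure (U := U) (x := fun i => t (Sum.inl i)) (y := x)
    (inl_mem_toricVariety ht) hx

variable (k) in
/-- The action of `T_U` on `X_U` by coordinatewise multiplication. -/
def torusAction {n m : ℕ} (U : Fin m → Fin n → ℤ[X]) :
    Action (torusGroup k U) (toricVariety k U) where
  act :=
    { map := fun z => ⟨fun i : Fin m => z.1 (Sum.inl (Sum.inl i)) * z.1 (Sum.inr i),
        smul_mem_toricVariety (U := U) (t := fun i => z.1 (Sum.inl i))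
          (x := fun i => z.1 (Sum.inr i)) z.2.1 z.2.2⟩
      exists_poly :=
        ⟨fun i : Fin m => (MvPolynomial.X (Sum.inl (Sum.inl i), 0) *
            MvPolynomial.X (Sum.inr i, 0) : SigmaPoly ((Fin m ⊕ Fin m) ⊕ Fin m) k),
          fun _ z (i : Fin m) => (eval_X_mul_X (ι := (Fin m ⊕ Fin m) ⊕ Fin m) z.1
            (Sum.inl (Sum.inl i)) (Sum.inr i)).symm⟩ }
  one_act := fun _ x => Subtype.ext (funext fun i => one_mul (x.1 i))
  mul_act := fun _ a b x => Subtype.ext (funext fun (i : Fin m) =>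
    mul_assoc (a.1 (Sum.inl i)) (b.1 (Sum.inl i)) (x.1 i))

end Torus

/-! ### The two directions of the characterization. -/

section Characterization

open scoped Polynomial
open SigmaPoly SigmaVariety

variable {k : Type u} [Field k] [DifferenceRing k]

/-- A toric variety contains its torus as a dense open subset, with an extending action. -/
theorem exists_torus_of_iso {X : SigmaVariety k} {n m : ℕ} {U : Fin m → Fin n → ℤ[X]}
    (e : Iso X (toricVariety k U)) :
    ∃ (j : Hom (torusVariety k U) X) (A : Action (torusGroup k U) X),
      j.IsOpenImmersion ∧ Dense j.image ∧ ∀ (K : SigmaExt k) (s t : (torusVariety k U).pts K),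
        A.act.map (pair s (j.map t)) = j.map ((torusGroup k U).mul.map (pair s t)) := by
  let j : Hom (torusVariety k U) X := e.inv.comp (torusInclusion k U)
  obtain ⟨Y, hY, hY'⟩ := e.hom.eval_map
  have hj : ∀ (K : SigmaExt k) (t : (torusVariety k U).pts K),
      e.hom.map (j.map t) = (torusInclusion k U).map t := fun K t => e.hom_inv K _
  -- The image is the locus where no pulled-back coordinate of `X_U` vanishes. The inclusion `⊇`
  -- uses that every `σ`-prime ideal is given by a point.
  have himage : j.image = {p | ∀ i, Ideal.Quotient.mk (vanishingIdeal X.pts) (Y i) ∉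
      p.1.asIdeal} := by
    ext p
    constructor
    · rintro ⟨K, t, rfl⟩ i hi
      rw [mk_mem_toSpec_iff, ← hY, hj] at hi
      exact torusVariety_ne_zero t.2 i hi
    · intro hp
      obtain ⟨K, x, rfl⟩ := X.exists_eq_toSpec p
      refine ⟨K, ⟨_, elim_mem_torusVariety (e.hom.map x).2 fun i => ?_⟩, ?_⟩
      · exact fun h => hp i ((hY K x i).symm.trans h)
      · congr 1
        exact (e.inv_hom K x).symm
  let A : Action (torusGroup k U) X :=
    { act := e.inv.comp ((torusAction k U).act.comp
        (Hom.lift (Hom.fst _ _) (e.hom.comp (Hom.snd _ _))))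
      one_act := fun K x =>
        (congrArg e.inv.map ((torusAction k U).one_act K (e.hom.map x))).trans (e.inv_hom K x)
      mul_act := fun K a b x => by
        refine congrArg e.inv.map (((torusAction k U).mul_act K a b (e.hom.map x)).trans ?_)
        exact congrArg (fun z => (torusAction k U).act.map (pair a z)) (e.hom_inv K _).symm }
  refine ⟨j, A, ⟨?_, ?_, ?_, ?_⟩, ?_, ?_⟩
  · rw [himage, Set.ofPred_forall]
    refine isOpen_iInter_of_finite fun i => ?_
    exact (PrimeSpectrum.basicOpen (Ideal.Quotient.mk (vanishingIdeal X.pts) (Y i))).2.preimage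
      continuous_subtype_val
  · intro K x hx
    rw [himage] at hx
    refine ⟨⟨_, elim_mem_torusVariety (e.hom.map x).2 fun i => ?_⟩, e.inv_hom K x⟩
    exact fun h => hx i ((hY K x i).symm.trans h)
  · intro K s t h
    have h' : (torusInclusion k U).map s = (torusInclusion k U).map t := by rw [← hj, ← hj, h]
    have h1 : ∀ i, s.1 (Sum.inl i) = t.1 (Sum.inl i) :=
      fun i => congrFun (congrArg Subtype.val h') i
    refine Subtype.ext ?_
    rw [torusVariety_eq_elim s.2, torusVariety_eq_elim t.2]
    simp only [h1]
    rfl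
  · intro f K t
    obtain ⟨a, b, hab⟩ := exists_denominator f
    have hY'' : ∀ (L : SigmaExt k) (s : (torusVariety k U).pts L) (g : SigmaPoly (Fin m) k),
        eval (j.map s).1 (subst Y g) = eval (fun i => s.1 (Sum.inl i)) g := by
      intro L s g
      have h1 : (e.hom.map (j.map s)).1 = fun i => s.1 (Sum.inl i) := congrArg Subtype.val (hj L s)
      have h2 := hY' L (j.map s) g
      rw [h1] at h2
      exact h2.symm
    refine ⟨subst Y a, subst Y b, fun h => ?_, fun L s => ?_⟩
    · exact (hab K (fun i => t.1 (Sum.inl i)) (torusVariety_ne_zero t.2)).1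
        ((hY'' K t b).symm.trans h)
    · have h := (hab L (fun i => s.1 (Sum.inl i)) (torusVariety_ne_zero s.2)).2
      rw [← torusVariety_eq_elim s.2, ← hY'', ← hY''] at h
      exact h
  -- Carried over to `X_U`, the function `f` vanishes on `T_U^*`, hence on its closure.
  · refine dense_image_of fun f hf K x hx => ?_
    obtain ⟨P, -, hP⟩ := e.inv.eval_map
    have h : eval (e.hom.map ⟨x, hx⟩).1 (subst P f) = 0 := by
      refine (e.hom.map ⟨x, hx⟩).2 _ ?_
      rintro L y ⟨t, ht, rfl⟩
      have hy : (fun j => laurentMonomial t (U j)) ∈ (toricVariety k U).pts L :=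
        subset_cohnClosure _ ⟨t, ht, rfl⟩
      refine (hP L ⟨_, hy⟩ f).symm.trans ?_
      exact hf L ⟨_, elim_mem_torusVariety hy fun i => laurentMonomial_ne_zero ht _⟩
    rw [← hP, e.inv_hom] at h
    exact h
  · intro K s t
    refine congrArg e.inv.map ?_
    exact congrArg (fun z => (torusAction k U).act.map (pair s z)) (hj K t)

/-- The point of `T_U` with parameter `t`. -/
noncomputable def torusPoint {n m : ℕ} (U : Fin m → Fin n → ℤ[X]) {K : SigmaExt k} (t : Fin n → K)
    (ht : ∀ i, t i ≠ 0) : (torusVariety k U).pts K :=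
  ⟨fun j => laurentMonomial t (Sum.elim U (fun j => -U j) j), laurent_mem_torusVariety U ht⟩

theorem torusPoint_mul {n m : ℕ} (U : Fin m → Fin n → ℤ[X]) {K : SigmaExt k} {s t : Fin n → K}
    (hs : ∀ i, s i ≠ 0) (ht : ∀ i, t i ≠ 0) :
    (torusGroup k U).mul.map (pair (torusPoint U s hs) (torusPoint U t ht)) =
      torusPoint U (s * t) fun i => mul_ne_zero (hs i) (ht i) :=
  Subtype.ext (funext fun _ => (laurentMonomial_mul_left s t _).symm)

theorem mem_torusVariety_iff {n m : ℕ} {U : Fin m → Fin n → ℤ[X]} {K : SigmaExt k}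
    {x : Fin m ⊕ Fin m → K} : x ∈ (torusVariety k U).pts K ↔
      x ∈ (cohnClosure (monomialFamily k (Sum.elim U fun j => -U j))).pts K := by
  rw [torusVariety_pts]
  rfl

/-- The parametrized points are dense in `T_U`, so identities on `X` need only be checked at their
images. -/
theorem mem_vanishingIdeal_of_torusPoint {X : SigmaVariety k} {n m : ℕ} {U : Fin m → Fin n → ℤ[X]}
    {J : Hom (torusVariety k U) X}
    (hJ : ∀ f : SigmaPoly X.ι k, (∀ (K : SigmaExt k) (t : (torusVariety k U).pts K),
      eval (J.map t).1 f = 0) → f ∈ vanishingIdeal X.pts)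
    {f : SigmaPoly X.ι k} (hf : ∀ (K : SigmaExt k) (t : Fin n → K) (ht : ∀ i, t i ≠ 0),
      eval (J.map (torusPoint U t ht)).1 f = 0) : f ∈ vanishingIdeal X.pts := by
  refine hJ f fun K z => ?_
  obtain ⟨P, -, hP⟩ := J.eval_map
  rw [hP]
  have hz : z.1 ∈ (cohnClosure (monomialFamily k (Sum.elim U fun j => -U j))).pts K :=
    mem_torusVariety_iff.1 z.2
  refine hz _ ?_
  rintro L _ ⟨t, ht, rfl⟩
  exact (hP L (torusPoint U t ht) f).symm.trans (hf L t ht)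

/-- The isotypic components of the coordinates of a torus in `X` extend to functions on `X`, if
the torus acts on `X`. -/
theorem exists_component {X : SigmaVariety k} {n m : ℕ} {U : Fin m → Fin n → ℤ[X]}
    (J : Hom (torusVariety k U) X) (C : Hom ((torusVariety k U).prod X) X)
    (hC : ∀ (K : SigmaExt k) (s t : (torusVariety k U).pts K),
      C.map (pair s (J.map t)) = J.map ((torusGroup k U).mul.map (pair s t))) (i : X.ι) :
    ∃ (c : (Fin n → ℤ[X]) →₀ k) (b : (Fin n → ℤ[X]) → SigmaPoly X.ι k),
      ∀ (K : SigmaExt k) (t : Fin n → K) (ht : ∀ i, t i ≠ 0),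
        ((J.map (torusPoint U t ht)).1 i = c.sum fun w a =>
          algebraMap k K a * laurentMonomial t w) ∧
        ∀ w, eval (J.map (torusPoint U t ht)).1 (b w) =
          algebraMap k K (c w) * laurentMonomial t w := by
  obtain ⟨P, hP⟩ := J.exists_poly
  obtain ⟨B, hB⟩ := C.exists_poly
  obtain ⟨c, hc⟩ := exists_expansion_scalar (Sum.elim U fun j => -U j) (P i)
  -- Coordinate `i` of `s·x` as a Laurent sum in `s`, with `σ`-polynomials in `x` as coefficients.
  obtain ⟨b, hb⟩ := exists_expansion (Sum.elim U fun j => -U j) (B i)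
  have hJc : ∀ (K : SigmaExt k) (t : Fin n → K) (ht : ∀ i, t i ≠ 0),
      (J.map (torusPoint U t ht)).1 i = c.sum fun w a => algebraMap k K a * laurentMonomial t w :=
    fun K t ht => (hP K _ i).trans (hc K t ht)
  have hCb : ∀ (K : SigmaExt k) (t : Fin n → K) (ht : ∀ i, t i ≠ 0) (x : X.pts K),
      (C.map (pair (torusPoint U t ht) x)).1 i =
        b.sum fun w f => eval x.1 f * laurentMonomial t w :=
    fun K t ht x => (hB K _ i).trans (hb K t x.1 ht)
  refine ⟨c, b, fun K t ht => ⟨hJc K t ht, ?_⟩⟩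
  refine eval_coeff_of_expansion (b := b) (J.map (torusPoint U t ht)).1
    (Finsupp.onFinset c.support (fun w => algebraMap k K (c w) * laurentMonomial t w)
      fun w hw => ?_) ?_
  · rw [Finsupp.mem_support_iff]
    intro h0
    rw [h0, map_zero, zero_mul] at hw
    exact hw rfl
  · intro L φ s hφ hs
    have hφt : ∀ i, φ (t i) ≠ 0 := fun i => (map_ne_zero φ).2 (ht i)
    -- The generic `s` lives over `L`, so `t` is moved there before `s·J(t) = J(st)` is applied.
    have hbase : (J.map (torusPoint U (fun i => φ (t i)) hφt)).1 =
        fun i => φ ((J.map (torusPoint U t ht)).1 i) := by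
      funext l
      rw [hP, hP, ← eval_map φ hφ]
      congr 2
      funext v
      exact (map_laurentMonomial φ.toRingHom hφ t _).symm
    have h := hCb L s hs (J.map (torusPoint U (fun i => φ (t i)) hφt))
    rw [hbase] at h
    rw [← h, hC, torusPoint_mul, hJc, Finsupp.onFinset_sum]
    · refine Finset.sum_congr rfl fun w _ => ?_
      beta_reduce
      have hw : φ (laurentMonomial t w) = laurentMonomial (fun i => φ (t i)) w :=
        map_laurentMonomial φ.toRingHom hφ t w
      rw [laurentMonomial_mul_left, map_mul, φ.commutes, ← hw]
      ring
    · intro w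
      rw [map_zero, zero_mul]

theorem isToric_of_action {X : SigmaVariety k} {n m : ℕ} {U : Fin m → Fin n → ℤ[X]}
    (J : Hom (torusVariety k U) X) (C : Hom ((torusVariety k U).prod X) X)
    (hJ : ∀ f : SigmaPoly X.ι k, (∀ (K : SigmaExt k) (t : (torusVariety k U).pts K),
      eval (J.map t).1 f = 0) → f ∈ vanishingIdeal X.pts)
    (hC : ∀ (K : SigmaExt k) (s t : (torusVariety k U).pts K),
      C.map (pair s (J.map t)) = J.map ((torusGroup k U).mul.map (pair s t))) :
    X.IsToric := by
  classical
  have := Fintype.ofFinite X.ι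
  choose c b hcb using exists_component J C hC
  -- The exponents that occur in some coordinate of `J`; `U'` enumerates them.
  let V : Finset (Fin n → ℤ[X]) := Finset.univ.biUnion fun i => (c i).support
  let U' : Fin V.card → Fin n → ℤ[X] := fun r => (V.equivFin.symm r).1
  have hU' : ∀ r, ∃ i, c i (U' r) ≠ 0 := by
    intro r
    obtain ⟨i, -, hi⟩ := Finset.mem_biUnion.1 (V.equivFin.symm r).2
    exact ⟨i, Finsupp.mem_support_iff.1 hi⟩
  -- Coordinate `i₀ r` contains the monomial of `U' r` with nonzero coefficient. Dividing its
  -- component by that coefficient gives `Q r`, which restricts to this monomial on the torus; `R`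
  -- reassembles the coordinates of `X`.
  choose i₀ hi₀ using hU'
  let Q : Fin V.card → SigmaPoly X.ι k := fun r =>
    MvPolynomial.C (c (i₀ r) (U' r))⁻¹ * b (i₀ r) (U' r)
  let R : X.ι → SigmaPoly (Fin V.card) k := fun i =>
    ∑ r, MvPolynomial.C (c i (U' r)) * MvPolynomial.X (r, 0)
  have hQ : ∀ (K : SigmaExt k) (t : Fin n → K) (ht : ∀ i, t i ≠ 0) (r : Fin V.card),
      eval (J.map (torusPoint U t ht)).1 (Q r) = laurentMonomial t (U' r) := by
    intro K t ht r
    rw [map_mul, eval_C, (hcb _ K t ht).2, ← mul_assoc, ← map_mul, inv_mul_cancel₀ (hi₀ r),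
      map_one, one_mul]
  have hR : ∀ (K : SigmaExt k) (t : Fin n → K) (ht : ∀ i, t i ≠ 0) (i : X.ι),
      eval (fun r => laurentMonomial t (U' r)) (R i) = (J.map (torusPoint U t ht)).1 i := by
    intro K t ht i
    rw [(hcb i K t ht).1, map_sum]
    simp only [map_mul, eval_C, eval_X_zero]
    rw [Finsupp.sum_of_support_subset (s := V), ← Finset.sum_coe_sort V]
    · exact Equiv.sum_comp V.equivFin.symm
        (fun w : V => algebraMap k K (c i w) * laurentMonomial t w.1)
    · exact Finset.subset_biUnion_of_mem (fun i => (c i).support) (Finset.mem_univ i)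
    · intro w _
      rw [map_zero, zero_mul]
  have hRpts : ∀ (K : SigmaExt k), ∀ y ∈ (toricVariety k U').pts K,
      (fun i => eval y (R i)) ∈ X.pts K := by
    intro K y hy
    refine eval_mem_of_mem_cohnClosure X R ?_ hy
    rintro L _ ⟨t, ht, rfl⟩
    simp only [hR L t ht]
    exact (J.map (torusPoint U t ht)).2
  have hQpts : ∀ (K : SigmaExt k), ∀ x ∈ X.pts K,
      (fun r => eval x (Q r)) ∈ (toricVariety k U').pts K := by
    intro K x hx f hf
    rw [← eval_subst]
    refine mem_vanishingIdeal_of_torusPoint hJ (fun L t ht => ?_) K x hx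
    rw [eval_subst]
    simp only [hQ L t ht]
    exact hf L _ ⟨t, ht, rfl⟩
  -- `Q` and `R` are inverse to each other at parametrized points, hence everywhere by density.
  have hRQ : ∀ (K : SigmaExt k) (y : Fin V.card → K), y ∈ (toricVariety k U').pts K →
      ∀ r, eval (fun i => eval y (R i)) (Q r) = y r := by
    intro K y hy r
    rw [← eval_subst, ← eval_X_zero y r]
    refine eval_eq_of_mem_cohnClosure ?_ hy
    rintro L _ ⟨t, ht, rfl⟩
    rw [eval_subst, eval_X_zero]
    simp only [hR L t ht]
    exact hQ L t ht r
  refine ⟨n, V.card, U', ⟨⟨Hom.ofPoly Q hQpts, Hom.ofPoly R hRpts, ?_, ?_⟩⟩⟩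
  · intro K x
    refine Subtype.ext (funext fun i => ?_)
    change eval (fun r => eval x.1 (Q r)) (R i) = x.1 i
    rw [← eval_subst, ← sub_eq_zero, ← eval_X_zero x.1 i, ← map_sub]
    refine mem_vanishingIdeal_of_torusPoint hJ (fun L t ht => ?_) K x.1 x.2
    rw [map_sub, eval_subst, eval_X_zero]
    simp only [hQ L t ht]
    rw [hR L t ht, sub_self]
  · exact fun K y => Subtype.ext (funext (hRQ K y.1 y.2))

end Characterization

theorem mainTheorem3 {k : Type u} [Field k] [CharZero k] [DifferenceRing k]
    (X : SigmaVariety k) :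
    X.IsToric ↔
      ∃ (T : SigmaVariety k) (H : T.GroupStructure) (j : SigmaVariety.Hom T X)
        (A : SigmaVariety.Action H X),
        H.IsTorus ∧ j.IsOpenImmersion ∧ Dense j.image ∧
          ∀ (K : SigmaExt k) (s t : T.pts K),
            A.act.map (SigmaVariety.pair s (j.map t)) =
              j.map (H.mul.map (SigmaVariety.pair s t)) := by
  constructor
  · rintro ⟨n, m, U, ⟨e⟩⟩
    obtain ⟨j, A, h⟩ := exists_torus_of_iso e
    exact ⟨torusVariety k U, torusGroup k U, j, A, torusGroup_isTorus U, h⟩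
  · rintro ⟨T, H, j, A, ⟨n, m, U, e, he⟩, -, hdense, hA⟩
    -- The immersion and the action are transported from `T` to `T_U` along `e`; `he` makes the
    -- transport respect multiplication.
    refine isToric_of_action (U := U) (j.comp e.inv) (A.act.comp
      (SigmaVariety.Hom.lift (e.inv.comp (SigmaVariety.Hom.fst _ _)) (SigmaVariety.Hom.snd _ _)))
      (fun f hf => SigmaVariety.mem_vanishingIdeal_of_dense hdense fun K t => ?_) fun K s t => ?_
    · have h := hf K (e.hom.map t)
      change SigmaPoly.eval (j.map (e.inv.map (e.hom.map t))).1 f = 0 at h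
      rwa [e.inv_hom] at h
    · refine (hA K (e.inv.map s) (e.inv.map t)).trans (congrArg j.map ?_)
      rw [← e.inv_hom K (H.mul.map _)]
      refine congrArg e.inv.map (Subtype.ext ?_)
      rw [he, e.hom_inv, e.hom_inv]
      rfl
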